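/- Let $K$ be a field, $n\ge 2$, $R=K[x_1,\dots,x_n]$, and let $M^d$ be the set of monomials of degree $d$ in $R$. For integers $m,h\ge 1$ there is a unique expression $h=\sum_{j=i}^{m}\binom{h(j)+j}{j}$ with $1\le i\le m$ and $h(m)\ge h(m-1)\ge\dots\ge h(i)\ge 0$, called the $m$th binomial representation of $h$; put $h^{<m>}=\sum_{j=i}^{m}\binom{h(j)+j+1}{j}$, and $0^{<m>}=0$. For an ideal $I$ generated by monomials let $H(I,d)=\dim_K I_d$, where $I_d$ is the space of homogeneous elements of degree $d$ in $I$. A set $V\subset M^d$ is called a Gotzmann set if the ideal $I$ generated by $V$ satisfies $H(I,d+1)=H(I,d)^{<n-1>}$. A set $V$ of monomials is called strongly stable if for all $u\in V$ and all $i<j$ with $x_j\mid u$ one has $\frac{x_i}{x_j}u\in V$. Let $Lex(n,d,a)$ be the set of the $a$ largest monomials of $M^d$ in the lexicographic order with $x_1>x_2>\dots>x_n$. Write $V\sim V'$ if some permutation of the variables carries $V$ onto $V'$. Theorem. Let $a\ge 1$ be an integer with $(n-1)$th binomial representation $a=\sum_{j=p}^{n-1}\binom{a(j)+j}{j}$.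 The following conditions are equivalent: (i) $a(n-1)=a(p)$; (ii) for every $d\ge 0$ and every Gotzmann set $V\subset M^d$ with $|V|=a$ and $\gcd(V)=1$, one has $V\sim Lex(n,d,a)$; (iii) for every $d\ge 0$ and every Gotzmann set $V\subset M^d$ with $|V|=a$ and $\gcd(V)=1$, one has $V\sim V'$ for some strongly stable set $V'$ of monomials of $R$. -/

import Mathlib

namespace GotzmannMonomial

/-- An `n`-th binomial representation
`h = ∑_{j = bot}^{n} C(coef j + j, j)`, `coef n ≥ coef (n-1) ≥ ⋯ ≥ coef bot ≥ 0`, `bot ≥ 1`.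
Only the values `coef j` with `bot ≤ j ≤ n` matter. -/
structure BinomRep (n h : ℕ) where
  /-- the lowest index -/
  bot : ℕ
  /-- the coefficients -/
  coef : ℕ → ℕ
  one_le_bot : 1 ≤ bot
  bot_le : bot ≤ n
  coef_le : ∀ j, bot ≤ j → j < n → coef j ≤ coef (j + 1)
  sum_eq : ∑ j ∈ Finset.Icc bot n, (coef j + j).choose j = h

/-- `∑_{j = bot}^{n} C(coef j + j + 1, j)`. -/
def BinomRep.shift {n h : ℕ} (r : BinomRep n h) : ℕ :=
  ∑ j ∈ Finset.Icc r.bot n, (r.coef j + j + 1).choose j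

open Classical in
/-- `h^{<n>}`: the shifted sum of the `n`-th binomial representation of `h` (which does not depend
on a choice, see `upper_eq`). If there is no representation (that is, `h = 0` or `n = 0`), the
value is `0`. -/
noncomputable def upper (n h : ℕ) : ℕ :=
  if H : Nonempty (BinomRep n h) then (Classical.choice H).shift else 0

theorem sum_lt_choose (c : ℕ → ℕ) (p : ℕ) (hp : 1 ≤ p) (n : ℕ) (hn : p ≤ n)
    (hc : ∀ j, p ≤ j → j < n → c j ≤ c (j + 1)) :
    ∑ j ∈ Finset.Icc p n, (c j + j).choose j < (c n + n + 1).choose n := by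
  induction n, hn using Nat.le_induction with
  | base =>
    obtain ⟨q, rfl⟩ : ∃ q, p = q + 1 := ⟨p - 1, by omega⟩
    rw [Finset.Icc_self, Finset.sum_singleton, Nat.choose_succ_succ' (c (q + 1) + (q + 1)) q]
    have : 0 < (c (q + 1) + (q + 1)).choose q := Nat.choose_pos (by omega)
    omega
  | succ m hm ih =>
    have h1 := ih (fun j h2 h3 => hc j h2 (by omega))
    have h2 := hc m hm (by omega)
    have h3 : (c m + m + 1).choose m ≤ (c (m + 1) + (m + 1)).choose m :=
      Nat.choose_le_choose m (by omega)
    rw [Finset.sum_Icc_succ_top (by omega), Nat.choose_succ_succ' (c (m + 1) + (m + 1)) m]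
    omega

theorem top_le (c e : ℕ → ℕ) (p q : ℕ) (hq : 1 ≤ q) (n : ℕ) (hpn : p ≤ n) (hqn : q ≤ n)
    (he : ∀ j, q ≤ j → j < n → e j ≤ e (j + 1))
    (h : ∑ j ∈ Finset.Icc p n, (c j + j).choose j = ∑ j ∈ Finset.Icc q n, (e j + j).choose j) :
    c n ≤ e n := by
  by_contra hlt
  have h1 := sum_lt_choose e q hq n hqn he
  have h2 : (e n + n + 1).choose n ≤ (c n + n).choose n := Nat.choose_le_choose n (by omega)
  have h3 : (c n + n).choose n ≤ ∑ j ∈ Finset.Icc p n, (c j + j).choose j :=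
    Finset.single_le_sum (f := fun j => (c j + j).choose j) (fun _ _ => Nat.zero_le _)
      (Finset.mem_Icc.2 ⟨hpn, le_rfl⟩)
  omega

theorem rep_unique (c e : ℕ → ℕ) (p q : ℕ) (hp : 1 ≤ p) (hq : 1 ≤ q) (n : ℕ)
    (hpn : p ≤ n) (hqn : q ≤ n)
    (hc : ∀ j, p ≤ j → j < n → c j ≤ c (j + 1)) (he : ∀ j, q ≤ j → j < n → e j ≤ e (j + 1))
    (h : ∑ j ∈ Finset.Icc p n, (c j + j).choose j = ∑ j ∈ Finset.Icc q n, (e j + j).choose j) :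
    p = q ∧ ∀ j, p ≤ j → j ≤ n → c j = e j := by
  have pos : ∀ (f : ℕ → ℕ) (s m : ℕ), s ≤ m →
      0 < ∑ j ∈ Finset.Icc s m, (f j + j).choose j := fun f s m hsm =>
    Finset.sum_pos (fun j _ => Nat.choose_pos (by omega)) ⟨s, Finset.mem_Icc.2 ⟨le_rfl, hsm⟩⟩
  induction n with
  | zero => omega
  | succ m ih =>
    have htop : c (m + 1) = e (m + 1) :=
      le_antisymm (top_le c e p q hq _ hpn hqn he h) (top_le e c q p hp _ hqn hpn hc h.symm)
    rw [Finset.sum_Icc_succ_top hpn, Finset.sum_Icc_succ_top hqn, htop] at h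
    have h' := Nat.add_right_cancel h
    by_cases h1 : p ≤ m
    · have h2 : q ≤ m := by
        by_contra h2
        have := pos c p m h1
        rw [h', Finset.Icc_eq_empty (by omega)] at this
        simp at this
      obtain ⟨h3, h4⟩ := ih h1 h2 (fun j a b => hc j a (by omega))
        (fun j a b => he j a (by omega)) h'
      refine ⟨h3, fun j a b => ?_⟩
      rcases Nat.lt_or_ge m j with hj | hj
      · obtain rfl : j = m + 1 := by omega
        exact htop
      · exact h4 j a hj
    · have h2 : ¬ q ≤ m := by
        intro h2
        have := pos e q m h2
        rw [← h', Finset.Icc_eq_empty (by omega)] at this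
        simp at this
      refine ⟨by omega, fun j a b => ?_⟩
      obtain rfl : j = m + 1 := by omega
      exact htop

/-- `upper n h` may be computed from any `n`-th binomial representation of `h`. -/
theorem upper_eq {n h : ℕ} (r : BinomRep n h) : upper n h = r.shift := by
  have H : Nonempty (BinomRep n h) := ⟨r⟩
  rw [upper, dif_pos H]
  generalize Classical.choice H = s
  obtain ⟨h1, h2⟩ := rep_unique s.coef r.coef s.bot r.bot s.one_le_bot r.one_le_bot n
    s.bot_le r.bot_le s.coef_le r.coef_le (s.sum_eq.trans r.sum_eq.symm)
  unfold BinomRep.shift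
  rw [← h1]
  refine Finset.sum_congr rfl fun j hj => ?_
  rw [Finset.mem_Icc] at hj
  rw [h2 j hj.1 hj.2]

/-- `M^d`: the monomials of degree `d` in `n` variables. A monomial is given by its exponent
vector; the variables `x_1, …, x_n` are indexed by `Fin n`. -/
def monomials (n d : ℕ) : Finset (Fin n →₀ ℕ) :=
  (Finset.univ : Finset (Fin n)).finsuppAntidiag d

/-- The ideal of `K[x_1, …, x_n]` generated by the monomials in `V`. -/
noncomputable def monomialIdeal (K : Type*) [Field K] {n : ℕ} (V : Finset (Fin n →₀ ℕ)) :
    Ideal (MvPolynomial (Fin n) K) :=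
  Ideal.span ((fun u => MvPolynomial.monomial u (1 : K)) '' (V : Set (Fin n →₀ ℕ)))

/-- The Hilbert function `H(I, d) = dim_K I_d`, where `I_d` is the space of the homogeneous
elements of degree `d` in `I`. -/
noncomputable def hilbert {K : Type*} [Field K] {n : ℕ} (I : Ideal (MvPolynomial (Fin n) K))
    (d : ℕ) : ℕ :=
  Module.finrank K
    ↥(Submodule.restrictScalars K I ⊓ MvPolynomial.homogeneousSubmodule (Fin n) K d)

/-- `V ⊆ M^d` is a Gotzmann set: the ideal `I` generated by `V` satisfies
`H(I, d + 1) = H(I, d)^{<n - 1>}`. -/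
def IsGotzmann (K : Type*) [Field K] {n : ℕ} (d : ℕ) (V : Finset (Fin n →₀ ℕ)) : Prop :=
  V ⊆ monomials n d ∧
    hilbert (monomialIdeal K V) (d + 1) = upper (n - 1) (hilbert (monomialIdeal K V) d)

/-- `gcd(V) = 1`: among the common divisors of the monomials in `V`, the monomial `1` is the
greatest. Divisibility of monomials is the componentwise order of the exponent vectors, in which
`0` stands for `1`. -/
def GcdEqOne {n : ℕ} (V : Finset (Fin n →₀ ℕ)) : Prop :=
  IsGLB (V : Set (Fin n →₀ ℕ)) 0

open Classical in
/-- `Lex(n, d, a)`: the first (greatest) `a` monomials of degree `d` in the lexicographic order,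
that is, those with fewer than `a` monomials of degree `d` above them. -/
noncomputable def lexSegment (n d a : ℕ) : Finset (Fin n →₀ ℕ) :=
  (monomials n d).filter fun u =>
    ((monomials n d).filter fun v => toLex u < toLex v).card < a

/-- `V` is strongly stable: for `u ∈ V`, `i < j` and `x_j ∣ u`, also `(x_i / x_j) u ∈ V`. -/
def StronglyStable {n : ℕ} (V : Finset (Fin n →₀ ℕ)) : Prop :=
  ∀ u ∈ V, ∀ i j : Fin n, i < j → u j ≠ 0 →
    u - Finsupp.single j 1 + Finsupp.single i 1 ∈ V

open Classical in
/-- `V ∼ V'`: some permutation `π` of the variables, acting by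
`π (∏ x_i ^ a_i) = ∏ x_{π i} ^ a_i`, carries `V` onto `V'`. -/
def PermEquiv {n : ℕ} (V V' : Finset (Fin n →₀ ℕ)) : Prop :=
  ∃ π : Equiv.Perm (Fin n), V.image (Finsupp.mapDomain π) = V'

end GotzmannMonomial

/-! The ideal generated by `V` is counted by its monomials, so `V` is a Gotzmann set exactly when
its `shadow` (the multiples by the variables) has the size that Macaulay's bound prescribes
(`isGotzmann_iff`).

If all coefficients of the representation equal `e`, put `q = e + 1`. Then `a = binSum q p n` is the
number of monomials of degree `q` that do not live on a given set `S` of `p` variables (`cofaces`),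
and `a^{<n-1>} = binSum (q + 1) p n` is the same count in degree `q + 1`. The heart of (i) ⇒ (ii) is
rigidity: for `p + 2 ≤ n` only the multiples `w · cofaces` have this size and this shadow
(`cofaceRigidity`). For `p = n - 1` the size is that of the set of all monomials of degree `q - 1`,
and only the multiples of that set occur (`eq_translate_mons`). Trivial gcd forces `w = 1`, and when
`S` consists of the last variables the cofaces form a lex segment.

Both the bound and rigidity come from splitting `V` by a variable `z` into the part free of `z` and
the quotient by `z` (`card_shadow_ge`), which matches the recursion `binSum_succ`. For strongly
stable sets the free part is large enough (`StableOn.binSum_le_card_free`), and compressions in two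
variables reduce the bound to that case. For rigidity, a compression in `x`, `y` keeps the number of
members free of a third variable `z`. If the compressed set has the expected form, this number is
known for `V` too, and equality in the splitting estimate reconstructs `V`.

(ii) ⇒ (iii) holds since lex segments are strongly stable. For (iii) ⇒ (i), Macaulay's bound is
attained by nested layers `z · M^c ∪ L`. Where the coefficients jump, `L` carries a linear factor
that may be chosen freely. A suitable choice leaves `L` without pure powers, whereas a strongly
stable set that contains a monomial in some variables contains a pure power of the first of them
(`not_stronglyStable_of_permEquiv`). -/

namespace GotzmannMonomial

open Finset

set_option linter.unusedSectionVars false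

/-! ### Binomial sums with constant coefficients -/

/-- `∑_{p ≤ j < n} C(q - 1 + j, j)`: the integers whose binomial representation has constant
coefficients. -/
def binSum (q p n : ℕ) : ℕ := ∑ j ∈ Ico p n, q.multichoose j

/-- Pascal's rule in each term. The two summands are the sizes expected of the quotient by a
variable and of the part free of it. -/
theorem binSum_succ (q p n : ℕ) :
    binSum (q + 1) (p + 1) (n + 1) = binSum q (p + 1) (n + 1) + binSum (q + 1) p n := by
  unfold binSum
  rw [← Finset.sum_Ico_add' (fun j => (q + 1).multichoose j) p n 1,
    ← Finset.sum_Ico_add' (fun j => q.multichoose j) p n 1, ← Finset.sum_add_distrib]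
  exact Finset.sum_congr rfl fun j _ => Nat.multichoose_succ_succ q j

theorem binSum_singleton (q n : ℕ) : binSum q n (n + 1) = q.multichoose n := by
  simp [binSum]

theorem binSum_eq_zero {q p n : ℕ} (h : n ≤ p) : binSum q p n = 0 := by
  simp [binSum, h]

theorem binSum_zero_left {p n : ℕ} (hp : 1 ≤ p) : binSum 0 p n = 0 := by
  unfold binSum
  refine Finset.sum_eq_zero fun j hj => ?_
  obtain ⟨k, rfl⟩ : ∃ k, j = k + 1 := ⟨j - 1, by have := (Finset.mem_Ico.1 hj).1; omega⟩
  exact Nat.multichoose_zero_succ k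

theorem binSum_one (p n : ℕ) : binSum 1 p n = n - p := by
  simp [binSum, Nat.multichoose_one]

theorem multichoose_symm (q n : ℕ) : (q + 1).multichoose n = (n + 1).multichoose q := by
  rw [Nat.multichoose_eq, Nat.multichoose_eq, show q + 1 + n - 1 = q + n by omega,
    show n + 1 + q - 1 = q + n by omega]
  exact Nat.choose_symm_add.symm

theorem binSum_bot (q n : ℕ) : binSum q 0 (n + 1) = (q + 1).multichoose n := by
  induction n with
  | zero => simp [binSum]
  | succ n ih =>
    rw [Nat.multichoose_succ_succ, ← ih]
    unfold binSum
    rw [Nat.Ico_zero_eq_range, Finset.sum_range_succ, add_comm, Nat.Ico_zero_eq_range]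

/-- The sum from `0` collapses to a single top term with `q` raised by one, so the case `p = 0`
reduces to a positive lower index. -/
theorem binSum_bot' (q n : ℕ) : binSum q 0 (n + 1) = binSum (q + 1) n (n + 1) := by
  rw [binSum_bot, binSum_singleton]

theorem binSum_top (q n : ℕ) : binSum (q + 1) n (n + 1) = (n + 1).multichoose q := by
  rw [binSum_singleton, multichoose_symm]

/-- The monomials of degree `q` in `n` variables either live on `p` given variables or do not;
`binSum` counts the second kind. -/
theorem binSum_add {q p n : ℕ} (hq : 1 ≤ q) (hpn : p ≤ n) :
    binSum q p n + p.multichoose q = n.multichoose q := by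
  have key : ∀ m : ℕ, ∑ j ∈ range m, q.multichoose j = m.multichoose q := by
    intro m
    cases m with
    | zero =>
      obtain ⟨k, rfl⟩ : ∃ k, q = k + 1 := ⟨q - 1, by omega⟩
      simp [Nat.multichoose_zero_succ]
    | succ m =>
      have h := binSum_bot q m
      rw [multichoose_symm] at h
      rwa [binSum, Nat.Ico_zero_eq_range] at h
  rw [← key p, ← key n, binSum, add_comm, Finset.sum_range_add_sum_Ico _ hpn]

theorem multichoose_strictMono {n : ℕ} (hn : 2 ≤ n) : StrictMono n.multichoose := by
  refine strictMono_nat_of_lt_succ fun q => ?_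
  obtain ⟨k, rfl⟩ : ∃ k, n = k + 2 := ⟨n - 2, by omega⟩
  have h : (k + 2).multichoose (q + 1) = (k + 1).multichoose (q + 1) + (k + 2).multichoose q :=
    Nat.multichoose_succ_succ (k + 1) q
  have : 0 < (k + 1).multichoose (q + 1) := by
    rw [Nat.multichoose_eq]
    exact Nat.choose_pos (by omega)
  omega

/-! ### Shadows and the splitting by a variable -/

section Shadow

variable {ι : Type*} [DecidableEq ι]

theorem mem_mons {s : Finset ι} {d : ℕ} {u : ι →₀ ℕ} :
    u ∈ s.finsuppAntidiag d ↔ u.degree = d ∧ ∀ i, i ∉ s → u i = 0 := by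
  rw [mem_finsuppAntidiag]
  have key : u.support ⊆ s ↔ ∀ i, i ∉ s → u i = 0 := by
    constructor
    · intro h i hi
      by_contra h0
      exact hi (h (Finsupp.mem_support_iff.2 h0))
    · intro h i hi
      by_contra h0
      exact Finsupp.mem_support_iff.1 hi (h i h0)
  rw [← key]
  refine and_congr_left fun h => ?_
  rw [Finsupp.degree_apply, Finset.sum_subset h fun i _ hi => Finsupp.notMem_support_iff.1 hi]

theorem card_mons (s : Finset ι) (d : ℕ) : #(s.finsuppAntidiag d) = (#s).multichoose d :=
  card_finsuppAntidiag_nat_eq_multichoose d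

/-- The multiples of the monomials in `V` by the variables in `s`. -/
noncomputable def shadow (s : Finset ι) (V : Finset (ι →₀ ℕ)) : Finset (ι →₀ ℕ) :=
  s.biUnion fun i => V.image (· + Finsupp.single i 1)

theorem mem_shadow {s : Finset ι} {V : Finset (ι →₀ ℕ)} {u : ι →₀ ℕ} :
    u ∈ shadow s V ↔ ∃ i ∈ s, ∃ v ∈ V, v + Finsupp.single i 1 = u := by
  simp [shadow]

theorem add_single_mem_shadow {s : Finset ι} {V : Finset (ι →₀ ℕ)} {u : ι →₀ ℕ} {i : ι}
    (hi : i ∈ s) (hu : u ∈ V) : u + Finsupp.single i 1 ∈ shadow s V :=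
  mem_shadow.2 ⟨i, hi, u, hu, rfl⟩

theorem shadow_subset {s : Finset ι} {d : ℕ} {V : Finset (ι →₀ ℕ)}
    (hV : V ⊆ s.finsuppAntidiag d) : shadow s V ⊆ s.finsuppAntidiag (d + 1) := by
  intro u hu
  obtain ⟨i, hi, v, hv, rfl⟩ := mem_shadow.1 hu
  obtain ⟨h1, h2⟩ := mem_mons.1 (hV hv)
  refine mem_mons.2 ⟨by simp [h1], fun j hj => ?_⟩
  have : j ≠ i := fun h => hj (h ▸ hi)
  simp [h2 j hj, this.symm]

theorem card_le_card_shadow {s : Finset ι} (hs : s.Nonempty) (V : Finset (ι →₀ ℕ)) :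
    #V ≤ #(shadow s V) := by
  obtain ⟨i, hi⟩ := hs
  refine Finset.card_le_card_of_injOn (· + Finsupp.single i 1)
    (fun u hu => add_single_mem_shadow hi hu) ?_
  exact fun u _ v _ h => add_right_cancel h

theorem card_vars_le_card_shadow {s : Finset ι} {V : Finset (ι →₀ ℕ)} (hV : V.Nonempty) :
    #s ≤ #(shadow s V) := by
  obtain ⟨u, hu⟩ := hV
  refine Finset.card_le_card_of_injOn (fun i => u + Finsupp.single i 1)
    (fun i hi => add_single_mem_shadow hi hu) ?_
  intro i _ j _ h
  exact Finsupp.single_left_injective one_ne_zero (add_left_cancel h)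

/-- The monomials of `V` that the variable `z` does not divide. -/
def free (z : ι) (V : Finset (ι →₀ ℕ)) : Finset (ι →₀ ℕ) := V.filter (· z = 0)

/-- The monomials `u` with `z u ∈ V`. -/
noncomputable def quo (z : ι) (V : Finset (ι →₀ ℕ)) : Finset (ι →₀ ℕ) :=
  (V.filter (· z ≠ 0)).image (· - Finsupp.single z 1)

theorem mem_free {z : ι} {V : Finset (ι →₀ ℕ)} {u : ι →₀ ℕ} :
    u ∈ free z V ↔ u ∈ V ∧ u z = 0 := by simp [free]

theorem sub_add_single {u : ι →₀ ℕ} {z : ι} (h : u z ≠ 0) :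
    u - Finsupp.single z 1 + Finsupp.single z 1 = u := by
  refine tsub_add_cancel_of_le ?_
  rw [Finsupp.single_le_iff]
  omega

theorem mem_quo {z : ι} {V : Finset (ι →₀ ℕ)} {u : ι →₀ ℕ} :
    u ∈ quo z V ↔ u + Finsupp.single z 1 ∈ V := by
  simp only [quo, mem_image, mem_filter]
  constructor
  · rintro ⟨v, ⟨hv, hz⟩, rfl⟩
    rwa [sub_add_single hz]
  · intro h
    exact ⟨_, ⟨h, by simp⟩, by simp⟩

theorem card_free_add_card_quo (z : ι) (V : Finset (ι →₀ ℕ)) : #(free z V) + #(quo z V) = #V := by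
  rw [quo, Finset.card_image_of_injOn, free, Finset.card_filter_add_card_filter_not]
  intro u hu v hv h
  simp only [coe_filter, Set.mem_ofPred_eq] at hu hv
  rw [← sub_add_single hu.2, ← sub_add_single hv.2]
  exact congrArg (· + Finsupp.single z 1) h

theorem free_subset {s : Finset ι} {d : ℕ} {V : Finset (ι →₀ ℕ)} (z : ι)
    (hV : V ⊆ s.finsuppAntidiag d) : free z V ⊆ (s.erase z).finsuppAntidiag d := by
  intro u hu
  obtain ⟨h1, h2⟩ := mem_free.1 hu
  obtain ⟨h3, h4⟩ := mem_mons.1 (hV h1)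
  refine mem_mons.2 ⟨h3, fun i hi => ?_⟩
  by_cases hiz : i = z
  · rwa [hiz]
  · exact h4 i fun h => hi (mem_erase.2 ⟨hiz, h⟩)

theorem quo_subset {s : Finset ι} {d : ℕ} {V : Finset (ι →₀ ℕ)} (z : ι)
    (hV : V ⊆ s.finsuppAntidiag (d + 1)) : quo z V ⊆ s.finsuppAntidiag d := by
  intro u hu
  obtain ⟨h1, h2⟩ := mem_mons.1 (hV (mem_quo.1 hu))
  refine mem_mons.2 ⟨by simpa using h1, fun i hi => ?_⟩
  have := h2 i hi
  rw [Finsupp.add_apply] at this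
  omega

/-- The first summand counts members of the shadow that are free of `z`. The second counts members
divisible by `z`: both `z · V` and `z` times the shadow of the quotient lie in the shadow of `V`. -/
theorem card_shadow_ge {s : Finset ι} {z : ι} (hz : z ∈ s) (V : Finset (ι →₀ ℕ)) :
    #(shadow (s.erase z) (free z V)) + #(V ∪ shadow s (quo z V)) ≤ #(shadow s V) := by
  have hinj : Function.Injective fun u : ι →₀ ℕ => u + Finsupp.single z 1 :=
    add_left_injective _
  rw [← Finset.card_image_of_injective (V ∪ shadow s (quo z V)) hinj,
    ← Finset.card_union_of_disjoint]
  · refine Finset.card_le_card (Finset.union_subset ?_ ?_)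
    · intro u hu
      obtain ⟨i, hi, v, hv, rfl⟩ := mem_shadow.1 hu
      exact add_single_mem_shadow (mem_of_mem_erase hi) (mem_free.1 hv).1
    · intro u hu
      obtain ⟨v, hv, rfl⟩ := mem_image.1 hu
      rcases mem_union.1 hv with h | h
      · exact add_single_mem_shadow hz h
      · obtain ⟨i, hi, w, hw, rfl⟩ := mem_shadow.1 h
        rw [add_right_comm]
        exact add_single_mem_shadow hi (mem_quo.1 hw)
  · rw [Finset.disjoint_left]
    intro u hu hu'
    obtain ⟨i, hi, v, hv, rfl⟩ := mem_shadow.1 hu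
    obtain ⟨w, -, hw⟩ := mem_image.1 hu'
    have h1 := DFunLike.congr_fun hw z
    simp [(mem_free.1 hv).2, ne_of_mem_erase hi] at h1

end Shadow

/-! ### Macaulay's bound for strongly stable sets -/

section Stable

variable {ι : Type*} [LinearOrder ι]

/-- Strong stability with respect to the variables in `s`. -/
def StableOn (s : Finset ι) (V : Finset (ι →₀ ℕ)) : Prop :=
  ∀ u ∈ V, ∀ i ∈ s, ∀ j ∈ s, i < j → u j ≠ 0 →
    u - Finsupp.single j 1 + Finsupp.single i 1 ∈ V

theorem StableOn.free {s : Finset ι} {V : Finset (ι →₀ ℕ)} (h : StableOn s V) (z : ι) :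
    StableOn (s.erase z) (free z V) := by
  intro u hu i hi j hj hij huj
  rw [mem_free] at hu ⊢
  refine ⟨h u hu.1 i (mem_of_mem_erase hi) j (mem_of_mem_erase hj) hij huj, ?_⟩
  simp [hu.2, ne_of_mem_erase hi]

theorem StableOn.quo {s : Finset ι} {V : Finset (ι →₀ ℕ)} (h : StableOn s V) (z : ι) :
    StableOn s (quo z V) := by
  intro u hu i hi j hj hij huj
  rw [mem_quo] at hu ⊢
  have h1 := h _ hu i hi j hj hij (by simp [huj])
  have hle : Finsupp.single j 1 ≤ u := by
    rw [Finsupp.single_le_iff]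
    omega
  rwa [← tsub_add_eq_add_tsub hle, add_right_comm] at h1

theorem StableOn.shadow_quo_subset {s : Finset ι} {V : Finset (ι →₀ ℕ)} (h : StableOn s V)
    {z : ι} (hz : z ∈ s) (hmax : ∀ i ∈ s, i ≤ z) : shadow s (GotzmannMonomial.quo z V) ⊆ V := by
  intro u hu
  obtain ⟨i, hi, v, hv, rfl⟩ := mem_shadow.1 hu
  rw [mem_quo] at hv
  rcases (hmax i hi).eq_or_lt with rfl | hlt
  · exact hv
  · have h1 := h _ hv i hi z hz hlt (by simp)
    rwa [add_tsub_cancel_right] at h1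

theorem StableOn.free_nonempty {s : Finset ι} {V : Finset (ι →₀ ℕ)} (h : StableOn s V)
    {z i : ι} (hz : z ∈ s) (hi : i ∈ s) (hiz : i < z) (hV : V.Nonempty) :
    (GotzmannMonomial.free z V).Nonempty := by
  obtain ⟨u, hu, hmin⟩ := Finset.exists_min_image V (fun u => u z) hV
  refine ⟨u, mem_free.2 ⟨hu, ?_⟩⟩
  by_contra h0
  have h1 := hmin _ (h u hu i hi z hz hiz h0)
  simp [hiz.ne] at h1
  omega

/-- Macaulay's lower bound for the shadow, at the numbers `binSum q p n`, for all sets with a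
property `P s V`. -/
def ShadowBound (P : Finset ι → Finset (ι →₀ ℕ) → Prop) (n : ℕ) : Prop :=
  ∀ (s : Finset ι) (V : Finset (ι →₀ ℕ)), #s = n → P s V → ∀ q p : ℕ, 1 ≤ q →
    binSum q p n ≤ #V → binSum (q + 1) p n + #V ≤ #(shadow s V) + binSum q p n

/-- The restriction of a strongly stable set to the hyperplane `z = 0` is large. -/
theorem StableOn.binSum_le_card_free {n : ℕ} (hn : 1 ≤ n)
    (hM : ShadowBound (ι := ι) StableOn n) {s : Finset ι} (hs : #s = n + 1) {z : ι} (hz : z ∈ s)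
    (hmax : ∀ i ∈ s, i ≤ z) (p q : ℕ) (V : Finset (ι →₀ ℕ)) (hV : StableOn s V)
    (hcard : binSum (q + 1) (p + 1) (n + 1) ≤ #V) :
    binSum (q + 1) p n ≤ #(GotzmannMonomial.free z V) := by
  have hs' : #(s.erase z) = n := by rw [Finset.card_erase_of_mem hz, hs]; rfl
  have hsub : ∀ W : Finset (ι →₀ ℕ), StableOn s W →
      shadow (s.erase z) (GotzmannMonomial.free z (GotzmannMonomial.quo z W)) ⊆
        GotzmannMonomial.free z W := by
    intro W hW u hu
    obtain ⟨i, hi, v, hv, rfl⟩ := mem_shadow.1 hu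
    rw [mem_free] at hv
    refine mem_free.2 ⟨hW.shadow_quo_subset hz hmax
      (add_single_mem_shadow (mem_of_mem_erase hi) hv.1), ?_⟩
    simp [hv.2, ne_of_mem_erase hi]
  induction q generalizing V with
  | zero =>
    by_contra! hlt
    have h1 := card_free_add_card_quo z V
    rw [zero_add, binSum_one] at hcard hlt
    -- A nonempty quotient has a member free of `z`; its `n` multiples by the other variables lie in
    -- the free part of `V`, which is too many.
    have h2 : (GotzmannMonomial.quo z V).Nonempty := Finset.card_pos.1 (by omega)
    obtain ⟨i, hi⟩ : (s.erase z).Nonempty := Finset.card_pos.1 (by omega)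
    have h3 := (hV.quo z).free_nonempty hz (mem_of_mem_erase hi)
      (lt_of_le_of_ne (hmax i (mem_of_mem_erase hi)) (ne_of_mem_erase hi)) h2
    have h4 := card_vars_le_card_shadow (s := s.erase z) h3
    have h5 := Finset.card_le_card (hsub V hV)
    omega
  | succ q ih =>
    by_contra! hlt
    have h1 := card_free_add_card_quo z V
    rw [binSum_succ (q + 1)] at hcard
    -- A small free part makes the quotient large. By induction the quotient then has a large free
    -- part, whose shadow lies in the free part of `V` by stability and is already too big.
    have h2 := ih (GotzmannMonomial.quo z V) (hV.quo z) (by omega)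
    have h3 := hM (s.erase z) _ hs' ((hV.quo z).free z) (q + 1) p (by omega) h2
    have h4 := Finset.card_le_card (hsub V hV)
    omega

/-- With `z` the last variable, the shadow contains `z · V` and, disjoint from it, the shadow of the
free part. The latter is bounded by induction on the number of variables. -/
theorem shadowBound_stableOn (n : ℕ) (hn : 1 ≤ n) : ShadowBound (ι := ι) StableOn n := by
  induction n, hn using Nat.le_induction with
  | base =>
    intro s V hs _ q p hq _
    have h1 := card_le_card_shadow (Finset.card_pos.1 (by omega : 0 < #s)) V
    rcases Nat.eq_zero_or_pos p with rfl | hp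
    · simpa [binSum, add_comm] using h1
    · rw [binSum_eq_zero hp, binSum_eq_zero hp]
      omega
  | succ n hn ih =>
    have key : ∀ (s : Finset ι) (V : Finset (ι →₀ ℕ)), #s = n + 1 → StableOn s V → ∀ q p : ℕ,
        1 ≤ q → binSum q (p + 1) (n + 1) ≤ #V →
        binSum (q + 1) (p + 1) (n + 1) + #V ≤ #(shadow s V) + binSum q (p + 1) (n + 1) := by
      intro s V hs hV q p hq hc
      have hne : s.Nonempty := Finset.card_pos.1 (by omega)
      have hz := s.max'_mem hne
      have hmax : ∀ i ∈ s, i ≤ s.max' hne := fun i hi => s.le_max' i hi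
      obtain ⟨q, rfl⟩ : ∃ k, q = k + 1 := ⟨q - 1, by omega⟩
      have h1 := hV.binSum_le_card_free hn ih hs hz hmax p q V hc
      have h2 := ih (s.erase (s.max' hne)) _ (by rw [Finset.card_erase_of_mem hz, hs]; rfl)
        (hV.free _) (q + 1) p (by omega) h1
      have h3 := card_shadow_ge hz V
      have h4 := Finset.card_le_card
        (Finset.subset_union_left (s₁ := V) (s₂ := shadow s (quo (s.max' hne) V)))
      rw [binSum_succ (q + 1)]
      omega
    intro s V hs hV q p hq hc
    cases p with
    | succ p => exact key s V hs hV q p hq hc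
    | zero =>
      rw [binSum_bot'] at hc ⊢
      rw [binSum_bot']
      obtain ⟨m, rfl⟩ : ∃ k, n = k + 1 := ⟨n - 1, by omega⟩
      exact key s V hs hV (q + 1) m (by omega) hc

end Stable

/-! ### Compressions in two variables -/

section Compress
variable {ι : Type*} [DecidableEq ι]

/-- Substitute the variable `x` for the variable `y`. -/
noncomputable def merge (x y : ι) (u : ι →₀ ℕ) : ι →₀ ℕ := u.erase y + Finsupp.single x (u y)

theorem merge_add (x y : ι) (u v : ι →₀ ℕ) : merge x y (u + v) = merge x y u + merge x y v := by
  simp only [merge, Finsupp.erase_add, Finsupp.add_apply, Finsupp.single_add]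
  abel

theorem merge_single_self (x y : ι) (t : ℕ) :
    merge x y (Finsupp.single y t) = Finsupp.single x t := by simp [merge]

theorem merge_single_of_ne (x : ι) {y i : ι} (h : i ≠ y) (t : ℕ) :
    merge x y (Finsupp.single i t) = Finsupp.single i t := by
  simp [merge, h]

theorem merge_add_single (x y : ι) (u : ι →₀ ℕ) :
    merge x y u + Finsupp.single y (u y) = u + Finsupp.single x (u y) := by
  rw [merge, add_right_comm, Finsupp.erase_add_single]

theorem eq_of_merge_eq {x y : ι} {u v : ι →₀ ℕ} (h : merge x y u = merge x y v)
    (hy : u y = v y) : u = v := by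
  have h1 := merge_add_single x y u
  rw [h, hy, merge_add_single] at h1
  exact (add_right_cancel h1).symm

/-- The number of elements of `V` over `w`. -/
noncomputable def fibreCard (x y : ι) (V : Finset (ι →₀ ℕ)) (w : ι →₀ ℕ) : ℕ :=
  #{v ∈ V | merge x y v = w}

/-- The position of `u` in its fibre, which is ordered by the exponent of `y`. -/
noncomputable def fibreRank (x y : ι) (V : Finset (ι →₀ ℕ)) (u : ι →₀ ℕ) : ℕ :=
  #{v ∈ V | merge x y v = merge x y u ∧ v y < u y}

theorem fibreRank_le (x y : ι) (V : Finset (ι →₀ ℕ)) (u : ι →₀ ℕ) : fibreRank x y V u ≤ u y := by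
  rw [← Finset.card_range (u y)]
  refine Finset.card_le_card_of_injOn (fun v => v y) (fun v hv => ?_) fun v hv w hw h => ?_
  · simpa using (mem_filter.1 hv).2.2
  · exact eq_of_merge_eq ((mem_filter.1 hv).2.1.trans (mem_filter.1 hw).2.1.symm) h

theorem fibreRank_lt {x y : ι} {V : Finset (ι →₀ ℕ)} {u : ι →₀ ℕ} (hu : u ∈ V) :
    fibreRank x y V u < fibreCard x y V (merge x y u) := by
  refine Finset.card_lt_card (Finset.ssubset_iff_of_subset (fun v hv => ?_) |>.2 ⟨u, ?_, ?_⟩)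
  · exact mem_filter.2 ⟨(mem_filter.1 hv).1, (mem_filter.1 hv).2.1⟩
  · simp [hu]
  · simp

theorem fibreRank_injOn {x y : ι} {V : Finset (ι →₀ ℕ)} {u v : ι →₀ ℕ} (hu : u ∈ V) (hv : v ∈ V)
    (h : merge x y u = merge x y v) (hr : fibreRank x y V u = fibreRank x y V v) : u = v := by
  have key : ∀ a b : ι →₀ ℕ, a ∈ V → merge x y a = merge x y b → a y < b y →
      fibreRank x y V a < fibreRank x y V b := by
    intro a b ha hab hlt
    refine Finset.card_lt_card (Finset.ssubset_iff_of_subset (fun v hv => ?_) |>.2 ⟨a, ?_, ?_⟩)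
    · obtain ⟨h1, h2, h3⟩ := mem_filter.1 hv
      exact mem_filter.2 ⟨h1, h2.trans hab, h3.trans hlt⟩
    · simp [ha, hab, hlt]
    · simp
  rcases lt_trichotomy (u y) (v y) with h1 | h1 | h1
  · exact absurd hr (key u v hu h h1).ne
  · exact eq_of_merge_eq h h1
  · exact absurd hr (key v u hv h.symm h1).ne'

/-- Move `u` down to the position in its fibre that its rank prescribes. -/
noncomputable def push (x y : ι) (V : Finset (ι →₀ ℕ)) (u : ι →₀ ℕ) : ι →₀ ℕ :=
  u - Finsupp.single y (u y - fibreRank x y V u) + Finsupp.single x (u y - fibreRank x y V u)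

theorem push_add_single (x y : ι) (V : Finset (ι →₀ ℕ)) (u : ι →₀ ℕ) :
    push x y V u + Finsupp.single y (u y - fibreRank x y V u) =
      u + Finsupp.single x (u y - fibreRank x y V u) := by
  rw [push, add_right_comm, tsub_add_cancel_of_le]
  rw [Finsupp.single_le_iff]
  omega

theorem merge_push {x y : ι} (hxy : x ≠ y) (V : Finset (ι →₀ ℕ)) (u : ι →₀ ℕ) :
    merge x y (push x y V u) = merge x y u := by
  have h := congrArg (merge x y) (push_add_single x y V u)
  rw [merge_add, merge_add, merge_single_self, merge_single_of_ne x hxy] at h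
  exact add_right_cancel h

theorem push_apply_right {x y : ι} (hxy : x ≠ y) (V : Finset (ι →₀ ℕ)) (u : ι →₀ ℕ) :
    push x y V u y = fibreRank x y V u := by
  have h := DFunLike.congr_fun (push_add_single x y V u) y
  have h1 := fibreRank_le x y V u
  simp [hxy] at h
  omega

theorem push_apply_of_ne {x y z : ι} (hx : z ≠ x) (hy : z ≠ y) (V : Finset (ι →₀ ℕ))
    (u : ι →₀ ℕ) : push x y V u z = u z := by
  have h := DFunLike.congr_fun (push_add_single x y V u) z
  simpa [hx.symm, hy.symm] using h

theorem push_mem_mons {x y : ι} {s : Finset ι} (hx : x ∈ s) (hy : y ∈ s) {d : ℕ}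
    (V : Finset (ι →₀ ℕ)) {u : ι →₀ ℕ} (hu : u ∈ s.finsuppAntidiag d) :
    push x y V u ∈ s.finsuppAntidiag d := by
  rw [mem_mons] at hu ⊢
  refine ⟨?_, fun i hi => ?_⟩
  · have h := congrArg Finsupp.degree (push_add_single x y V u)
    simp only [map_add, Finsupp.degree_single] at h
    omega
  · rw [push_apply_of_ne (ne_of_mem_of_not_mem hx hi).symm (ne_of_mem_of_not_mem hy hi).symm]
    exact hu.2 i hi

theorem push_injOn {x y : ι} (hxy : x ≠ y) (V : Finset (ι →₀ ℕ)) :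
    Set.InjOn (push x y V) V := by
  intro u hu v hv h
  refine fibreRank_injOn (x := x) (y := y) hu hv ?_ ?_
  · rw [← merge_push hxy V u, h, merge_push hxy]
  · rw [← push_apply_right hxy, h, push_apply_right hxy]

/-- The compression of `V` towards `x` in the variables `x`, `y`: in each set of monomials that
differ only in their exponents of `x` and `y`, the members of `V` are replaced by as many monomials
with the smallest exponents of `y`. -/
noncomputable def compress (x y : ι) (V : Finset (ι →₀ ℕ)) : Finset (ι →₀ ℕ) :=
  V.image (push x y V)

theorem card_compress {x y : ι} (hxy : x ≠ y) (V : Finset (ι →₀ ℕ)) : #(compress x y V) = #V :=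
  Finset.card_image_of_injOn (push_injOn hxy V)

theorem mem_compress {x y : ι} (hxy : x ≠ y) {V : Finset (ι →₀ ℕ)} {u : ι →₀ ℕ} :
    u ∈ compress x y V ↔ u y < fibreCard x y V (merge x y u) := by
  constructor
  · intro h
    obtain ⟨v, hv, rfl⟩ := mem_image.1 h
    rw [push_apply_right hxy, merge_push hxy]
    exact fibreRank_lt hv
  · intro h
    have h1 : ({v ∈ V | merge x y v = merge x y u}.image (fibreRank x y V)) =
        range (fibreCard x y V (merge x y u)) := by
      refine Finset.eq_of_subset_of_card_le (fun k hk => ?_) ?_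
      · obtain ⟨v, hv, rfl⟩ := mem_image.1 hk
        obtain ⟨hv1, hv2⟩ := mem_filter.1 hv
        rw [mem_range, ← hv2]
        exact fibreRank_lt hv1
      · rw [card_range, Finset.card_image_of_injOn, fibreCard]
        intro v hv w hw hvw
        obtain ⟨hv1, hv2⟩ := mem_filter.1 hv
        obtain ⟨hw1, hw2⟩ := mem_filter.1 hw
        exact fibreRank_injOn hv1 hw1 (hv2.trans hw2.symm) hvw
    have h2 : u y ∈ range (fibreCard x y V (merge x y u)) := mem_range.2 h
    rw [← h1] at h2
    obtain ⟨v, hv, hvu⟩ := mem_image.1 h2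
    obtain ⟨hv1, hv2⟩ := mem_filter.1 hv
    refine mem_image.2 ⟨v, hv1, eq_of_merge_eq (x := x) (y := y) ?_ ?_⟩
    · rw [merge_push hxy, hv2]
    · rw [push_apply_right hxy, hvu]

/-- Compressed sets are described by the sizes of their fibres, so it suffices to bound the fibres
of the shadow from below. Multiplication by a variable other than `y` embeds fibres; passing to the
fibre over `x · w` gains one element. -/
theorem shadow_compress_subset {x y : ι} (hxy : x ≠ y) {s : Finset ι} (hx : x ∈ s) (hy : y ∈ s)
    (V : Finset (ι →₀ ℕ)) : shadow s (compress x y V) ⊆ compress x y (shadow s V) := by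
  intro u hu
  obtain ⟨i, hi, v, hv, rfl⟩ := mem_shadow.1 hu
  rw [mem_compress hxy] at hv ⊢
  rw [merge_add]
  by_cases hiy : i = y
  · subst hiy
    rw [merge_single_self]
    have hne : {w ∈ V | merge x i w = merge x i v}.Nonempty :=
      Finset.card_pos.1 (lt_of_le_of_lt (Nat.zero_le _) hv)
    obtain ⟨m, hm, hmax⟩ := Finset.exists_max_image _ (fun w => w i) hne
    obtain ⟨hm1, hm2⟩ := mem_filter.1 hm
    -- The multiples of the fibre by `x`, together with `y` times its member of largest
    -- `y`-exponent, which is new.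
    have h1 : insert (m + Finsupp.single i 1)
        ({w ∈ V | merge x i w = merge x i v}.image (· + Finsupp.single x 1)) ⊆
        {w ∈ shadow s V | merge x i w = merge x i v + Finsupp.single x 1} := by
      intro w hw
      rcases mem_insert.1 hw with rfl | hw
      · refine mem_filter.2 ⟨add_single_mem_shadow hy hm1, ?_⟩
        rw [merge_add, hm2, merge_single_self]
      · obtain ⟨w, hw', rfl⟩ := mem_image.1 hw
        obtain ⟨h1, h2⟩ := mem_filter.1 hw'
        refine mem_filter.2 ⟨add_single_mem_shadow hx h1, ?_⟩
        rw [merge_add, h2, merge_single_of_ne x hxy]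
    have h2 := Finset.card_le_card h1
    rw [Finset.card_insert_of_notMem, Finset.card_image_of_injective _ (add_left_injective _)] at h2
    · rw [Finsupp.add_apply, Finsupp.single_eq_same]
      unfold fibreCard at hv ⊢
      omega
    · intro h
      obtain ⟨w, hw, hwm⟩ := mem_image.1 h
      have h3 := hmax w hw
      have h4 := DFunLike.congr_fun hwm i
      simp [hxy] at h4
      omega
  · rw [merge_single_of_ne x hiy, Finsupp.add_apply, Finsupp.single_eq_of_ne (Ne.symm hiy), add_zero]
    refine hv.trans_le (Finset.card_le_card_of_injOn (· + Finsupp.single i 1) (fun w hw => ?_) ?_)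
    · obtain ⟨h1, h2⟩ := mem_filter.1 hw
      refine mem_filter.2 ⟨add_single_mem_shadow hi h1, ?_⟩
      rw [merge_add, h2, merge_single_of_ne x hiy]
    · exact fun a _ b _ h => add_right_cancel h

theorem card_shadow_compress_le {x y : ι} (hxy : x ≠ y) {s : Finset ι} (hx : x ∈ s) (hy : y ∈ s)
    (V : Finset (ι →₀ ℕ)) : #(shadow s (compress x y V)) ≤ #(shadow s V) := by
  rw [← card_compress hxy (shadow s V)]
  exact Finset.card_le_card (shadow_compress_subset hxy hx hy V)

theorem compress_subset {x y : ι} {s : Finset ι} (hx : x ∈ s) (hy : y ∈ s) {d : ℕ}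
    {V : Finset (ι →₀ ℕ)} (hV : V ⊆ s.finsuppAntidiag d) :
    compress x y V ⊆ s.finsuppAntidiag d := by
  intro u hu
  obtain ⟨v, hv, rfl⟩ := mem_image.1 hu
  exact push_mem_mons hx hy V (hV hv)

/-- Compression moves only the exponents of `x` and `y`. This invariant is what carries information
from the compressed set back to `V` in the rigidity proofs. -/
theorem card_free_compress {x y z : ι} (hxy : x ≠ y) (hx : z ≠ x) (hy : z ≠ y)
    (V : Finset (ι →₀ ℕ)) : #(free z (compress x y V)) = #(free z V) := by
  have h : free z (compress x y V) = (free z V).image (push x y V) := by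
    ext u
    simp only [mem_free, compress, mem_image]
    constructor
    · rintro ⟨⟨v, hv, rfl⟩, hz⟩
      rw [push_apply_of_ne hx hy] at hz
      exact ⟨v, ⟨hv, hz⟩, rfl⟩
    · rintro ⟨v, ⟨hv, hz⟩, rfl⟩
      exact ⟨⟨v, hv, rfl⟩, by rwa [push_apply_of_ne hx hy]⟩
  rw [h, Finset.card_image_of_injOn]
  exact (push_injOn hxy V).mono fun u hu => (mem_free.1 hu).1

theorem sum_weight_compress_lt {x y : ι} (hxy : x ≠ y) (ρ : ι → ℕ) (hρ : ρ x < ρ y)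
    {V : Finset (ι →₀ ℕ)} (hV : compress x y V ≠ V) :
    ∑ u ∈ compress x y V, Finsupp.weight ρ u < ∑ u ∈ V, Finsupp.weight ρ u := by
  have key : ∀ u : ι →₀ ℕ, Finsupp.weight ρ (push x y V u) + (u y - fibreRank x y V u) * ρ y =
      Finsupp.weight ρ u + (u y - fibreRank x y V u) * ρ x := by
    intro u
    have h := congrArg (Finsupp.weight ρ) (push_add_single x y V u)
    simpa only [map_add, Finsupp.weight_single, smul_eq_mul] using h
  rw [compress, Finset.sum_image (push_injOn hxy V)]
  refine Finset.sum_lt_sum (fun u _ => ?_) ?_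
  · have h1 := key u
    have h2 := Nat.mul_le_mul_left (u y - fibreRank x y V u) hρ.le
    omega
  · by_contra! hcon
    refine hV ?_
    have h : ∀ u ∈ V, push x y V u = u := by
      intro u hu
      have h0 : u y - fibreRank x y V u = 0 := by
        by_contra hne
        have h1 := key u
        have h2 := Nat.mul_lt_mul_of_pos_left hρ (Nat.pos_of_ne_zero hne)
        have h3 := hcon u hu
        omega
      rw [push, h0]
      simp
    rw [compress]
    ext u
    constructor
    · intro hu
      obtain ⟨v, hv, rfl⟩ := mem_image.1 hu
      rwa [h v hv]
    · exact fun hu => mem_image.2 ⟨u, hu, h u hu⟩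

end Compress

/-! ### Reduction to strongly stable sets -/

section Induction

variable {ι : Type*} [LinearOrder ι]

theorem stableOn_of_compress_eq {s : Finset ι} {V : Finset (ι →₀ ℕ)}
    (h : ∀ x ∈ s, ∀ y ∈ s, x < y → compress x y V = V) : StableOn s V := by
  intro u hu i hi j hj hij huj
  have hu' := hu
  rw [← h i hi j hj hij, mem_compress hij.ne] at hu' ⊢
  have h1 : merge i j (u - Finsupp.single j 1 + Finsupp.single i 1) = merge i j u := by
    conv_rhs => rw [← sub_add_single huj]
    rw [merge_add, merge_add, merge_single_self, merge_single_of_ne i hij.ne]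
  rw [h1]
  refine lt_of_le_of_lt ?_ hu'
  simp [hij.ne]

/-- To prove something for all finite sets of monomials, one may assume them strongly stable, if
the property passes from the compressions of a set to the set. -/
theorem compress_induction (s : Finset ι) {P : Finset (ι →₀ ℕ) → Prop}
    (stable : ∀ V, StableOn s V → P V)
    (step : ∀ V, ∀ x ∈ s, ∀ y ∈ s, x < y → P (compress x y V) → P V) (V : Finset (ι →₀ ℕ)) :
    P V := by
  -- A variable weighs as much as there are smaller variables in `s`. A compression towards a
  -- smaller variable that changes the set lowers the total weight, so the process terminates.
  induction hN : ∑ u ∈ V, Finsupp.weight (fun i => #{j ∈ s | j < i}) u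
    using Nat.strong_induction_on generalizing V with
  | _ N ih =>
    by_cases h : ∀ x ∈ s, ∀ y ∈ s, x < y → compress x y V = V
    · exact stable V (stableOn_of_compress_eq h)
    · push Not at h
      obtain ⟨x, hx, y, hy, hxy, hne⟩ := h
      refine step V x hx y hy hxy (ih _ ?_ _ rfl)
      rw [← hN]
      refine sum_weight_compress_lt hxy.ne _ ?_ hne
      refine Finset.card_lt_card (Finset.ssubset_iff_of_subset (fun j hj => ?_) |>.2 ⟨x, ?_, ?_⟩)
      · obtain ⟨h1, h2⟩ := mem_filter.1 hj
        exact mem_filter.2 ⟨h1, h2.trans hxy⟩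
      · simp [hx, hxy]
      · simp

theorem shadowBound (n : ℕ) (hn : 1 ≤ n) : ShadowBound (ι := ι) (fun _ _ => True) n := by
  intro s V hs _ q p hq
  refine compress_induction s (P := fun V => binSum q p n ≤ #V →
    binSum (q + 1) p n + #V ≤ #(shadow s V) + binSum q p n)
    (fun V hV => shadowBound_stableOn n hn s V hs hV q p hq) ?_ V
  intro V x hx y hy hxy ih h
  rw [card_compress hxy.ne] at ih
  have := card_shadow_compress_le hxy.ne hx hy V
  have := ih h
  omega

end Induction

/-! ### Multiples of a set by a monomial, and complements of faces -/

section Translate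
variable {ι : Type*} [DecidableEq ι]

/-- The multiples of the monomials in `A` by `w`. -/
noncomputable def translate (w : ι →₀ ℕ) (A : Finset (ι →₀ ℕ)) : Finset (ι →₀ ℕ) :=
  A.image (w + ·)

theorem mem_translate {w u : ι →₀ ℕ} {A : Finset (ι →₀ ℕ)} :
    u ∈ translate w A ↔ ∃ m ∈ A, w + m = u := mem_image

theorem card_translate (w : ι →₀ ℕ) (A : Finset (ι →₀ ℕ)) : #(translate w A) = #A :=
  Finset.card_image_of_injective _ (add_right_injective w)

theorem translate_mono (w : ι →₀ ℕ) {A B : Finset (ι →₀ ℕ)} (h : A ⊆ B) :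
    translate w A ⊆ translate w B := Finset.image_subset_image h

theorem translate_translate (v w : ι →₀ ℕ) (A : Finset (ι →₀ ℕ)) :
    translate v (translate w A) = translate (v + w) A := by
  ext u
  simp [mem_translate, add_assoc]

theorem translate_zero (A : Finset (ι →₀ ℕ)) : translate 0 A = A := by
  ext u
  simp [mem_translate]

theorem shadow_translate (s : Finset ι) (w : ι →₀ ℕ) (A : Finset (ι →₀ ℕ)) :
    shadow s (translate w A) = translate w (shadow s A) := by
  ext u
  simp only [mem_shadow, mem_translate]
  constructor
  · rintro ⟨i, hi, _, ⟨m, hm, rfl⟩, rfl⟩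
    exact ⟨_, ⟨i, hi, m, hm, rfl⟩, by rw [add_assoc]⟩
  · rintro ⟨_, ⟨i, hi, m, hm, rfl⟩, rfl⟩
    exact ⟨i, hi, _, ⟨m, hm, rfl⟩, by rw [add_assoc]⟩

theorem free_translate {w : ι →₀ ℕ} {z : ι} (hw : w z = 0) (A : Finset (ι →₀ ℕ)) :
    free z (translate w A) = translate w (free z A) := by
  ext u
  simp only [mem_free, mem_translate]
  constructor
  · rintro ⟨⟨m, hm, rfl⟩, h⟩
    refine ⟨m, ⟨hm, ?_⟩, rfl⟩
    simpa [hw] using h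
  · rintro ⟨m, ⟨hm, h⟩, rfl⟩
    exact ⟨⟨m, hm, rfl⟩, by simp [hw, h]⟩

theorem eq_translate_quo {z : ι} {V : Finset (ι →₀ ℕ)} (h : ∀ u ∈ V, u z ≠ 0) :
    V = translate (Finsupp.single z 1) (quo z V) := by
  ext u
  rw [mem_translate]
  constructor
  · intro hu
    have h1 := sub_add_single (h u hu)
    exact ⟨u - Finsupp.single z 1, mem_quo.2 (by rwa [h1]), by rw [add_comm, h1]⟩
  · rintro ⟨m, hm, rfl⟩
    rw [add_comm]
    exact mem_quo.1 hm

theorem exists_eq_translate {w : ι →₀ ℕ} {V B : Finset (ι →₀ ℕ)} (h : V ⊆ translate w B) :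
    ∃ A ⊆ B, V = translate w A := by
  refine ⟨B.filter (w + · ∈ V), Finset.filter_subset _ _, ?_⟩
  ext u
  rw [mem_translate]
  constructor
  · intro hu
    obtain ⟨m, hm, rfl⟩ := mem_translate.1 (h hu)
    exact ⟨m, mem_filter.2 ⟨hm, hu⟩, rfl⟩
  · rintro ⟨m, hm, rfl⟩
    exact (mem_filter.1 hm).2

theorem exists_ne_zero_of_degree {u : ι →₀ ℕ} (h : u.degree ≠ 0) : ∃ i, u i ≠ 0 := by
  by_contra! h0
  exact h (by rw [show u = 0 from Finsupp.ext h0]; simp)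

theorem exists_eq_single_of_degree {u : ι →₀ ℕ} (h : u.degree = 1) :
    ∃ i, u = Finsupp.single i 1 := by
  obtain ⟨i, hi⟩ := exists_ne_zero_of_degree (u := u) (by omega)
  have h1 := sub_add_single hi
  have h2 := congrArg Finsupp.degree h1
  simp only [map_add, Finsupp.degree_single, h] at h2
  have h3 := (Finsupp.degree_eq_zero_iff _).1 (Nat.succ_injective h2)
  rw [h3, zero_add] at h1
  exact ⟨i, h1.symm⟩

theorem shadow_mons {s : Finset ι} (q : ℕ) :
    shadow s (s.finsuppAntidiag q) = s.finsuppAntidiag (q + 1) := by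
  refine (shadow_subset (Finset.Subset.refl _)).antisymm fun u hu => ?_
  obtain ⟨h1, h2⟩ := mem_mons.1 hu
  obtain ⟨i, hi⟩ := exists_ne_zero_of_degree (u := u) (by omega)
  have his : i ∈ s := by
    by_contra h
    exact hi (h2 i h)
  rw [← sub_add_single hi]
  refine add_single_mem_shadow his (mem_mons.2 ⟨?_, fun j hj => by simp [h2 j hj]⟩)
  have h3 := congrArg Finsupp.degree (sub_add_single hi)
  simp only [map_add, Finsupp.degree_single] at h3
  omega

/-- The monomials of degree `q` in the variables `s` that some variable outside `S` divides. -/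
noncomputable def cofaces (s S : Finset ι) (q : ℕ) : Finset (ι →₀ ℕ) :=
  s.finsuppAntidiag q \ S.finsuppAntidiag q

theorem mem_cofaces {s S : Finset ι} {q : ℕ} {u : ι →₀ ℕ} :
    u ∈ cofaces s S q ↔ u ∈ s.finsuppAntidiag q ∧ ∃ i, i ∉ S ∧ u i ≠ 0 := by
  rw [cofaces, mem_sdiff]
  refine and_congr_right fun h => ?_
  rw [mem_mons, not_and, not_forall]
  constructor
  · intro h1
    obtain ⟨i, hi⟩ := h1 (mem_mons.1 h).1
    exact ⟨i, by simpa using hi⟩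
  · rintro ⟨i, h1, h2⟩ -
    exact ⟨i, by simp [h1, h2]⟩

theorem card_cofaces {s S : Finset ι} (hS : S ⊆ s) {q : ℕ} (hq : 1 ≤ q) :
    #(cofaces s S q) = binSum q #S #s := by
  have h := binSum_add hq (Finset.card_le_card hS)
  rw [cofaces, Finset.card_sdiff_of_subset (finsuppAntidiag_mono hS q), card_mons, card_mons]
  omega

theorem cofaces_empty (s : Finset ι) {q : ℕ} (hq : 1 ≤ q) :
    cofaces s ∅ q = s.finsuppAntidiag q := by
  rw [cofaces, finsuppAntidiag_empty_of_ne_zero (by omega), sdiff_empty]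

theorem shadow_cofaces_subset (s S : Finset ι) (q : ℕ) :
    shadow s (cofaces s S q) ⊆ cofaces s S (q + 1) := by
  intro u hu
  obtain ⟨i, hi, v, hv, rfl⟩ := mem_shadow.1 hu
  obtain ⟨h1, j, hj, hvj⟩ := mem_cofaces.1 hv
  exact mem_cofaces.2 ⟨shadow_subset (Finset.Subset.refl _) (add_single_mem_shadow hi h1), j, hj,
    by simp [hvj]⟩

theorem free_mons (s : Finset ι) (z : ι) (q : ℕ) :
    free z (s.finsuppAntidiag q) = (s.erase z).finsuppAntidiag q := by
  refine (free_subset z (Finset.Subset.refl _)).antisymm fun u hu => mem_free.2 ⟨?_, ?_⟩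
  · exact finsuppAntidiag_mono (Finset.erase_subset z s) q hu
  · exact (mem_mons.1 hu).2 z (Finset.notMem_erase z s)

theorem free_cofaces (s S : Finset ι) (z : ι) (q : ℕ) :
    free z (cofaces s S q) = cofaces (s.erase z) (S.erase z) q := by
  rw [cofaces, cofaces, ← free_mons, ← free_mons]
  ext u
  simp only [mem_free, mem_sdiff]
  tauto

theorem card_free_eq_zero {z : ι} {V : Finset (ι →₀ ℕ)} :
    #(free z V) = 0 ↔ ∀ u ∈ V, u z ≠ 0 := by
  rw [Finset.card_eq_zero, free, Finset.filter_eq_empty_iff]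

end Translate

/-! ### Equality when the size is that of all monomials of some degree -/

section Extremal
variable {ι : Type*} [LinearOrder ι]

/-- If a set with the smallest possible shadow has a large restriction to the hyperplane `z = 0`,
then it is determined by the quotient by `z`. -/
theorem shadow_quo_subset_of_le_card_free {s : Finset ι} {z : ι} (hz : z ∈ s) {n : ℕ}
    (hn : 1 ≤ n) (hs : #s = n + 1) {p q : ℕ} (hq : 1 ≤ q) {V : Finset (ι →₀ ℕ)}
    (hV : #V = binSum q (p + 1) (n + 1)) (hsh : #(shadow s V) ≤ binSum (q + 1) (p + 1) (n + 1))
    (hf : binSum q p n ≤ #(free z V)) :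
    shadow s (quo z V) ⊆ V ∧ #(free z V) = binSum q p n ∧
      #(shadow (s.erase z) (free z V)) ≤ binSum (q + 1) p n := by
  have h1 := shadowBound n hn (s.erase z) (free z V)
    (by rw [Finset.card_erase_of_mem hz, hs]; rfl) trivial q p hq hf
  have h2 := card_shadow_ge hz V
  have h3 := Finset.card_le_card
    (Finset.subset_union_left (s₁ := V) (s₂ := shadow s (quo z V)))
  rw [binSum_succ] at hsh
  refine ⟨?_, by omega, by omega⟩
  -- The lower bounds for the shadow of the free part and for `V` already exhaust the allowed size,
  -- so the shadow of the quotient adds nothing to `V`.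
  have h4 := Finset.eq_of_subset_of_card_le
    (Finset.subset_union_left (s₁ := V) (s₂ := shadow s (quo z V))) (by omega)
  exact Finset.union_eq_left.1 h4.symm

theorem exists_mem_ne_ne {s : Finset ι} (hs : 3 ≤ #s) (x y : ι) : ∃ z ∈ s, z ≠ x ∧ z ≠ y := by
  have h1 := Finset.pred_card_le_card_erase (s := s) (a := x)
  have h2 := Finset.pred_card_le_card_erase (s := s.erase x) (a := y)
  obtain ⟨z, hz⟩ : ((s.erase x).erase y).Nonempty := Finset.card_pos.1 (by omega)
  simp only [mem_erase] at hz
  exact ⟨z, hz.2.2, hz.2.1, hz.1⟩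

/-- A set of monomials with as many elements as there are monomials of degree `q`, and with the
smallest possible shadow, consists of all multiples of some monomial. -/
theorem eq_translate_mons {s : Finset ι} (hs : 2 ≤ #s) (d : ℕ) {V : Finset (ι →₀ ℕ)} {q : ℕ}
    (hV : V ⊆ s.finsuppAntidiag d) (hcard : #V = (#s).multichoose q)
    (hsh : #(shadow s V) ≤ (#s).multichoose (q + 1)) :
    ∃ w, V = translate w (s.finsuppAntidiag q) := by
  induction d generalizing V q with
  | zero =>
    have h1 := Finset.card_le_card hV
    rw [card_mons, Nat.multichoose_zero_right, hcard] at h1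
    rcases Nat.eq_zero_or_pos q with rfl | hq
    · obtain ⟨w, rfl⟩ := Finset.card_eq_one.1 (hcard.trans (Nat.multichoose_zero_right _))
      exact ⟨w, by simp [translate]⟩
    · have h2 := multichoose_strictMono hs hq
      rw [Nat.multichoose_zero_right] at h2
      omega
  | succ d ihd =>
    rcases Nat.eq_zero_or_pos q with rfl | hq
    · obtain ⟨w, rfl⟩ := Finset.card_eq_one.1 (hcard.trans (Nat.multichoose_zero_right _))
      exact ⟨w, by simp [translate]⟩
    obtain ⟨q, rfl⟩ : ∃ k, q = k + 1 := ⟨q - 1, by omega⟩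
    obtain ⟨n, hn⟩ : ∃ n, #s = n + 2 := ⟨#s - 2, by omega⟩
    have ha : ∀ (V : Finset (ι →₀ ℕ)) (z : ι), V ⊆ s.finsuppAntidiag (d + 1) →
        #V = (#s).multichoose (q + 1) → #(shadow s V) ≤ (#s).multichoose (q + 1 + 1) →
        #(free z V) = 0 → ∃ w, V = translate w (s.finsuppAntidiag (q + 1)) := by
      intro V z hV hcard hsh hz
      have h1 := eq_translate_quo (card_free_eq_zero.1 hz)
      rw [h1, card_translate] at hcard
      rw [h1, shadow_translate, card_translate] at hsh
      obtain ⟨w, hw⟩ := ihd (quo_subset z hV) hcard hsh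
      rw [hw, translate_translate] at h1
      exact ⟨_, h1⟩
    have hb : ∀ (V : Finset (ι →₀ ℕ)) (z : ι), z ∈ s → V ⊆ s.finsuppAntidiag (d + 1) →
        #V = (#s).multichoose (q + 1) → #(shadow s V) ≤ (#s).multichoose (q + 1 + 1) →
        (n + 1).multichoose (q + 1) ≤ #(free z V) →
        ∃ w, V = translate w (s.finsuppAntidiag (q + 1)) := by
      intro V z hz hV hcard hsh hf
      rw [hn, ← binSum_top] at hcard hsh
      rw [← binSum_top] at hf
      obtain ⟨h1, h2, -⟩ := shadow_quo_subset_of_le_card_free hz (by omega) hn (by omega)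
        hcard hsh hf
      rw [binSum_top] at hcard h2
      have h3 := card_free_add_card_quo z V
      rw [hcard, h2, Nat.multichoose_succ_succ (n + 1)] at h3
      have h4 : #(quo z V) = (#s).multichoose q := by
        rw [hn]
        exact Nat.add_left_cancel h3
      obtain ⟨w, hw⟩ := ihd (quo_subset z hV) h4
        ((Finset.card_le_card h1).trans (by rw [hcard, hn]))
      rw [hw, shadow_translate, shadow_mons] at h1
      refine ⟨w, (Finset.eq_of_subset_of_card_le h1 ?_).symm⟩
      rw [card_translate, card_mons, hcard, hn]
    revert hV hcard hsh
    refine compress_induction s (P := fun V => V ⊆ s.finsuppAntidiag (d + 1) →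
      #V = (#s).multichoose (q + 1) → #(shadow s V) ≤ (#s).multichoose (q + 1 + 1) →
      ∃ w, V = translate w (s.finsuppAntidiag (q + 1))) ?_ ?_ V
    · intro V hst hV hcard hsh
      have hne : s.Nonempty := Finset.card_pos.1 (by omega)
      have hz := s.max'_mem hne
      refine hb V _ hz hV hcard hsh ?_
      rw [← binSum_top]
      refine hst.binSum_le_card_free (by omega) (shadowBound_stableOn (n + 1) (by omega)) hn hz
        (fun i hi => s.le_max' i hi) n _ V ?_
      rw [binSum_top, ← hn, hcard]
    · intro V x hx y hy hxy ih hV hcard hsh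
      obtain ⟨w, hw⟩ := ih (compress_subset hx hy hV) ((card_compress hxy.ne V).trans hcard)
        ((card_shadow_compress_le hxy.ne hx hy V).trans hsh)
      -- With two variables there is no third one, but none is needed: either `x` divides all of
      -- `V`, or one member free of `x` is already enough for `hb`.
      rcases Nat.eq_zero_or_pos n with rfl | hn0
      · rcases Nat.eq_zero_or_pos #(free x V) with h0 | h0
        · exact ha V x hV hcard hsh h0
        · exact hb V x hx hV hcard hsh (by rw [Nat.multichoose_one]; omega)
      · obtain ⟨z, hz, hzx, hzy⟩ := exists_mem_ne_ne (by omega : 3 ≤ #s) x y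
        have h1 := card_free_compress hxy.ne hzx hzy V
        rw [hw] at h1
        -- The number of members of `V` free of `z` is read off from the compressed set: maximal if
        -- `z` does not divide `w`, and zero otherwise.
        by_cases hwz : w z = 0
        · rw [free_translate hwz, card_translate, free_mons, card_mons,
            Finset.card_erase_of_mem hz, hn] at h1
          exact hb V z hz hV hcard hsh h1.le
        · refine ha V z hV hcard hsh (h1.symm.trans (card_free_eq_zero.2 fun u hu => ?_))
          obtain ⟨m, -, rfl⟩ := mem_translate.1 hu
          simp [hwz]

end Extremal

/-! ### Equality for complements of faces -/

section Rigidity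

variable {ι : Type*} [LinearOrder ι]

/-- The classification of the sets with `binSum q p n` elements and the smallest possible shadow,
for a fixed number `n` of variables. -/
def CofaceRigidity (ι : Type*) [LinearOrder ι] (n : ℕ) : Prop :=
  ∀ (s : Finset ι), #s = n → ∀ (d : ℕ) (V : Finset (ι →₀ ℕ)) (q p : ℕ), 1 ≤ q → p + 2 ≤ n →
    V ⊆ s.finsuppAntidiag d → #V = binSum q p n → #(shadow s V) ≤ binSum (q + 1) p n →
    ∃ w, ∃ S ⊆ s, #S = p ∧ V = translate w (cofaces s S q)

theorem eq_translate_cofaces_empty {s : Finset ι} (hs : 2 ≤ #s) (d : ℕ) {V : Finset (ι →₀ ℕ)}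
    {q : ℕ} (hq : 1 ≤ q) (hV : V ⊆ s.finsuppAntidiag d) (hcard : #V = binSum q 0 #s)
    (hsh : #(shadow s V) ≤ binSum (q + 1) 0 #s) :
    ∃ w, V = translate w (cofaces s ∅ q) := by
  obtain ⟨n, hn⟩ : ∃ n, #s = n + 1 := ⟨#s - 1, by omega⟩
  rw [cofaces_empty s hq]
  refine eq_translate_mons hs d hV ?_ ?_
  · rw [hcard, hn, binSum_bot', binSum_top]
  · rwa [hn, binSum_bot', binSum_top, ← hn] at hsh

/-- The set is of the expected form if its restriction to `z = 0` has the size that it has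
when `z` is one of the variables of the face. -/
theorem eq_translate_cofaces_of_le_card_free {n : ℕ} (ihn : CofaceRigidity ι n)
    {s : Finset ι} (hs : #s = n + 1) {d q p : ℕ} (hq : 1 ≤ q) (hp : p + 2 ≤ n)
    (ihd : ∀ (V : Finset (ι →₀ ℕ)) (k : ℕ), 1 ≤ k → V ⊆ s.finsuppAntidiag d →
      #V = binSum k (p + 1) (n + 1) → #(shadow s V) ≤ binSum (k + 1) (p + 1) (n + 1) →
      ∃ w, ∃ S ⊆ s, #S = p + 1 ∧ V = translate w (cofaces s S k))
    {V : Finset (ι →₀ ℕ)} {z : ι} (hz : z ∈ s) (hV : V ⊆ s.finsuppAntidiag (d + 1))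
    (hcard : #V = binSum q (p + 1) (n + 1))
    (hsh : #(shadow s V) ≤ binSum (q + 1) (p + 1) (n + 1)) (hf : binSum q p n ≤ #(free z V)) :
    ∃ w, ∃ S ⊆ s, #S = p + 1 ∧ V = translate w (cofaces s S q) := by
  obtain ⟨h1, h2, h3⟩ := shadow_quo_subset_of_le_card_free hz (by omega) hs hq hcard hsh hf
  have h4 := card_free_add_card_quo z V
  have hse : #(s.erase z) = n := by rw [Finset.card_erase_of_mem hz, hs]; rfl
  obtain ⟨q, rfl⟩ : ∃ k, q = k + 1 := ⟨q - 1, by omega⟩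
  have h5 : #(quo z V) = binSum q (p + 1) (n + 1) := by
    have := binSum_succ q p n
    omega
  rcases Nat.eq_zero_or_pos q with rfl | hq'
  -- The quotient is empty, so no member of `V` involves `z`. The face found in the remaining
  -- variables is enlarged by `z`.
  · rw [binSum_zero_left (by omega)] at h5
    have h6 : free z V = V := Finset.eq_of_subset_of_card_le (Finset.filter_subset _ _) (by omega)
    obtain ⟨w, S, hS, hSp, hVS⟩ := ihn (s.erase z) hse (d + 1) (free z V) 1 p le_rfl hp
      (free_subset z hV) h2 h3
    have hzS : z ∉ S := fun h => Finset.notMem_erase z s (hS h)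
    have hS' : insert z S ⊆ s :=
      Finset.insert_subset hz (hS.trans (Finset.erase_subset z s))
    have hc : #(insert z S) = p + 1 := by rw [Finset.card_insert_of_notMem hzS, hSp]
    refine ⟨w, insert z S, hS', hc, Finset.eq_of_subset_of_card_le ?_ ?_⟩
    · rw [h6] at hVS
      rw [hVS]
      refine translate_mono w fun u hu => ?_
      obtain ⟨h7, i, hi, hui⟩ := mem_cofaces.1 hu
      refine mem_cofaces.2 ⟨finsuppAntidiag_mono (Finset.erase_subset z s) _ h7, i, ?_, hui⟩
      rw [mem_insert, not_or]
      refine ⟨?_, hi⟩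
      rintro rfl
      exact hui ((mem_mons.1 h7).2 i (Finset.notMem_erase i s))
    · rw [card_translate, card_cofaces hS' le_rfl, hc, hs, hcard]
  · have h6 := Finset.card_le_card h1
    obtain ⟨w, S, hS, hSp, hVS⟩ := ihd (quo z V) q hq' (quo_subset z hV) h5 (by omega)
    refine ⟨w, S, hS, hSp, Finset.eq_of_subset_of_card_le ?_ ?_⟩
    · have h7 := shadowBound (n + 1) (by omega) s (quo z V) hs trivial q (p + 1) hq' h5.ge
      rw [← Finset.eq_of_subset_of_card_le h1 (by omega), hVS, shadow_translate]
      exact translate_mono w (shadow_cofaces_subset s S q)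
    · rw [card_translate, card_cofaces hS hq, hSp, hs, hcard]

/-- The set is of the expected form if its restriction to `z = 0` has the size that it has
when `z` is not one of the variables of the face. -/
theorem eq_translate_cofaces_of_card_free_eq {n : ℕ} (ihn : CofaceRigidity ι n)
    {s : Finset ι} (hs : #s = n + 1) {d q p : ℕ} (hq : 1 ≤ q) (hn : 2 ≤ n) (hp : p + 1 ≤ n)
    {V : Finset (ι →₀ ℕ)} {z : ι} (hz : z ∈ s) (hV : V ⊆ s.finsuppAntidiag (d + 1))
    (hcard : #V = binSum q p (n + 1)) (hsh : #(shadow s V) ≤ binSum (q + 1) p (n + 1))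
    (hf : #(free z V) = binSum q p n) :
    ∃ w, ∃ S ⊆ s, #S = p ∧ V = translate w (cofaces s S q) := by
  have hse : #(s.erase z) = n := by rw [Finset.card_erase_of_mem hz, hs]; rfl
  have hlast : ∀ k, binSum k p (n + 1) = binSum k p n + k.multichoose n := fun k =>
    Finset.sum_Ico_succ_top (by omega) _
  obtain ⟨q, rfl⟩ : ∃ k, q = k + 1 := ⟨q - 1, by omega⟩
  have h1 := shadowBound n (by omega) (s.erase z) (free z V) hse trivial (q + 1) p hq hf.ge
  have h2 := card_shadow_ge hz V
  have h3 := card_free_add_card_quo z V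
  -- What remains is the top term of the sum, which by symmetry is the number of all monomials of
  -- degree `q` in `s`. So `eq_translate_mons` applies to the quotient.
  have h4 : #(quo z V) = (#s).multichoose q := by
    rw [hs, ← multichoose_symm]
    have := hlast (q + 1)
    omega
  have h5 : #(V ∪ shadow s (quo z V)) ≤ (#s).multichoose (q + 1) := by
    rw [hs, ← multichoose_symm]
    have := hlast (q + 1 + 1)
    omega
  have h6 := Finset.card_le_card
    (Finset.subset_union_right (s₁ := V) (s₂ := shadow s (quo z V)))
  obtain ⟨w, hw⟩ := eq_translate_mons (by omega) d (quo_subset z hV) h4 (h6.trans h5)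
  have h7 : shadow s (quo z V) = translate w (s.finsuppAntidiag (q + 1)) := by
    rw [hw, shadow_translate, shadow_mons]
  have h8 : #(shadow s (quo z V)) = (#s).multichoose (q + 1) := by
    rw [h7, card_translate, card_mons]
  have h9 : V ⊆ translate w (s.finsuppAntidiag (q + 1)) := by
    rw [← h7]
    exact Finset.union_eq_right.1
      (Finset.eq_of_subset_of_card_le Finset.subset_union_right (by omega)).symm
  have hpos : 0 < binSum (q + 1) p n := by
    have h10 : n - p ≤ binSum (q + 1) p n := by
      rw [← binSum_one]
      refine Finset.sum_le_sum fun j _ => ?_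
      rw [Nat.multichoose_one, Nat.multichoose_eq]
      exact Nat.choose_pos (by omega)
    omega
  have hwz : w z = 0 := by
    obtain ⟨u, hu⟩ : (free z V).Nonempty := Finset.card_pos.1 (by omega)
    obtain ⟨h10, h11⟩ := mem_free.1 hu
    obtain ⟨m, -, rfl⟩ := mem_translate.1 (h9 h10)
    rw [Finsupp.add_apply] at h11
    omega
  have hfree : free z V ⊆ translate w ((s.erase z).finsuppAntidiag (q + 1)) := by
    rw [← free_mons, ← free_translate hwz]
    exact Finset.filter_subset_filter _ h9
  obtain ⟨A, hA, hVA⟩ := exists_eq_translate hfree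
  have hAcard : #A = binSum (q + 1) p n := by rw [← hf, hVA, card_translate]
  have hAsh : #(shadow (s.erase z) A) ≤ binSum (q + 1 + 1) p n := by
    rw [← card_translate w, ← shadow_translate, ← hVA]
    have := hlast (q + 1 + 1)
    have h10 := (multichoose_symm (q + 1) n)
    rw [← hs] at h10
    omega
  have hdeg : ∀ {k : ℕ} {v : ι →₀ ℕ} {B : Finset (ι →₀ ℕ)}, B ⊆ (s.erase z).finsuppAntidiag k →
      A = translate v B → v.degree + k = q + 1 := by
    intro k v B hB hAB
    obtain ⟨u, hu⟩ : A.Nonempty := Finset.card_pos.1 (by omega)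
    have h10 := (mem_mons.1 (hA hu)).1
    rw [hAB] at hu
    obtain ⟨m, hm, rfl⟩ := mem_translate.1 hu
    rw [map_add, (mem_mons.1 (hB hm)).1] at h10
    exact h10
  obtain ⟨S, hS, hSp, hAS⟩ : ∃ S ⊆ s.erase z, #S = p ∧ A ⊆ cofaces (s.erase z) S (q + 1) := by
    rcases Nat.lt_or_ge (p + 1) n with hlt | hge
    · obtain ⟨v, S, hS, hSp, hAS⟩ := ihn (s.erase z) hse (q + 1) A (q + 1) p hq hlt hA hAcard hAsh
      have h10 : v.degree = 0 := by
        have := hdeg Finset.sdiff_subset hAS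
        omega
      rw [Finsupp.degree_eq_zero_iff] at h10
      rw [h10, translate_zero] at hAS
      exact ⟨S, hS, hSp, hAS.le⟩
    -- Here the rigidity hypothesis `p + 2 ≤ n` fails. Instead `A` consists of all multiples of one
    -- variable `i`, and the face is formed by the other variables of `s.erase z`.
    · obtain ⟨m, rfl⟩ : ∃ m, n = m + 1 := ⟨n - 1, by omega⟩
      obtain rfl : p = m := by omega
      rw [binSum_top, ← hse] at hAcard hAsh
      obtain ⟨v, hv⟩ := eq_translate_mons (by omega) (q + 1) hA hAcard hAsh
      obtain ⟨i, rfl⟩ := exists_eq_single_of_degree (u := v) (by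
        have := hdeg (Finset.Subset.refl _) hv
        omega)
      have hi : ∀ u ∈ A, u i ≠ 0 := by
        intro u hu
        rw [hv] at hu
        obtain ⟨m, -, rfl⟩ := mem_translate.1 hu
        simp
      have his : i ∈ s.erase z := by
        by_contra his
        obtain ⟨u, hu⟩ : A.Nonempty := Finset.card_pos.1 (by
          rw [← card_translate w, ← hVA, hf]
          exact hpos)
        exact hi u hu ((mem_mons.1 (hA hu)).2 i his)
      refine ⟨(s.erase z).erase i, Finset.erase_subset _ _, ?_, fun u hu => ?_⟩
      · rw [Finset.card_erase_of_mem his, hse]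
        rfl
      · exact mem_cofaces.2 ⟨hA hu, i, Finset.notMem_erase _ _, hi u hu⟩
  have hS' := hS.trans (Finset.erase_subset z s)
  refine ⟨w, S, hS', hSp, Finset.eq_of_subset_of_card_le (fun u hu => ?_) ?_⟩
  · by_cases huz : u z = 0
    · have h10 : u ∈ free z V := mem_free.2 ⟨hu, huz⟩
      rw [hVA] at h10
      obtain ⟨m, hm, rfl⟩ := mem_translate.1 h10
      obtain ⟨h11, i, hi, hmi⟩ := mem_cofaces.1 (hAS hm)
      exact mem_translate.2 ⟨m, mem_cofaces.2
        ⟨finsuppAntidiag_mono (Finset.erase_subset z s) _ h11, i, hi, hmi⟩, rfl⟩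
    · obtain ⟨m, hm, rfl⟩ := mem_translate.1 (h9 hu)
      refine mem_translate.2 ⟨m, mem_cofaces.2 ⟨hm, z, ?_, by simpa [hwz] using huz⟩, rfl⟩
      exact fun h => Finset.notMem_erase z s (hS h)
  · rw [card_translate, card_cofaces hS' hq, hSp, hs, hcard]

/-- Induction on the number of variables, then on the degree, then along compressions. For a third
variable `z`, the compressed set shows whether `z` divides everything, lies in the face, or lies
outside it; each case has its own reconstruction of `V`. -/
theorem cofaceRigidity (n : ℕ) : CofaceRigidity ι n := by
  induction n with
  | zero =>
    intro s _ d V q p _ hp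
    omega
  | succ n ihn =>
    intro s hs d V q p hq hp hV hcard hsh
    rcases Nat.eq_zero_or_pos p with rfl | hp0
    · rw [← hs] at hcard hsh
      obtain ⟨w, hw⟩ := eq_translate_cofaces_empty (by omega) d hq hV hcard hsh
      exact ⟨w, ∅, Finset.empty_subset s, rfl, hw⟩
    obtain ⟨p, rfl⟩ : ∃ k, p = k + 1 := ⟨p - 1, by omega⟩
    induction d generalizing V q with
    | zero =>
      have h1 := Finset.card_le_card hV
      have h2 : n + 1 - (p + 1) ≤ binSum q (p + 1) (n + 1) := by
        rw [← binSum_one]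
        refine Finset.sum_le_sum fun j _ => ?_
        rw [Nat.multichoose_one, Nat.multichoose_eq]
        exact Nat.choose_pos (by omega)
      rw [card_mons, Nat.multichoose_zero_right] at h1
      omega
    | succ d ihd =>
      have ihd' : ∀ (V : Finset (ι →₀ ℕ)) (k : ℕ), 1 ≤ k → V ⊆ s.finsuppAntidiag d →
          #V = binSum k (p + 1) (n + 1) → #(shadow s V) ≤ binSum (k + 1) (p + 1) (n + 1) →
          ∃ w, ∃ S ⊆ s, #S = p + 1 ∧ V = translate w (cofaces s S k) :=
        fun V k hk h1 h2 h3 => ihd V k hk h1 h2 h3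
      revert hV hcard hsh
      refine compress_induction s (P := fun V => V ⊆ s.finsuppAntidiag (d + 1) →
        #V = binSum q (p + 1) (n + 1) → #(shadow s V) ≤ binSum (q + 1) (p + 1) (n + 1) →
        ∃ w, ∃ S ⊆ s, #S = p + 1 ∧ V = translate w (cofaces s S q)) ?_ ?_ V
      · intro V hst hV hcard hsh
        have hne : s.Nonempty := Finset.card_pos.1 (by omega)
        have hz := s.max'_mem hne
        refine eq_translate_cofaces_of_le_card_free ihn hs hq (by omega) ihd' hz hV hcard hsh ?_
        obtain ⟨k, rfl⟩ : ∃ k, q = k + 1 := ⟨q - 1, by omega⟩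
        exact hst.binSum_le_card_free (by omega) (shadowBound_stableOn n (by omega)) hs hz
          (fun i hi => s.le_max' i hi) p k V hcard.ge
      · intro V x hx y hy hxy ih hV hcard hsh
        obtain ⟨w, S, hS, hSp, hw⟩ := ih (compress_subset hx hy hV)
          ((card_compress hxy.ne V).trans hcard)
          ((card_shadow_compress_le hxy.ne hx hy V).trans hsh)
        obtain ⟨z, hz, hzx, hzy⟩ := exists_mem_ne_ne (by omega : 3 ≤ #s) x y
        have h1 := card_free_compress hxy.ne hzx hzy V
        rw [hw] at h1
        by_cases hwz : w z = 0
        · rw [free_translate hwz, card_translate, free_cofaces,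
            card_cofaces (Finset.erase_subset_erase z hS) hq, Finset.card_erase_of_mem hz, hs] at h1
          by_cases hzS : z ∈ S
          · rw [Finset.card_erase_of_mem hzS, hSp] at h1
            exact eq_translate_cofaces_of_le_card_free ihn hs hq (by omega) ihd' hz hV hcard hsh
              h1.le
          · rw [Finset.erase_eq_of_notMem hzS, hSp] at h1
            exact eq_translate_cofaces_of_card_free_eq ihn hs hq (by omega) (by omega) hz hV hcard
              hsh h1.symm
        · have h2 : #(free z V) = 0 := h1.symm.trans (card_free_eq_zero.2 fun u hu => by
            obtain ⟨m, -, rfl⟩ := mem_translate.1 hu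
            simp [hwz])
          have h3 := eq_translate_quo (card_free_eq_zero.1 h2)
          rw [h3, card_translate] at hcard
          rw [h3, shadow_translate, card_translate] at hsh
          obtain ⟨v, S, hS, hSp, hv⟩ := ihd' _ q hq (quo_subset z hV) hcard hsh
          rw [hv, translate_translate] at h3
          exact ⟨_, S, hS, hSp, h3⟩

end Rigidity

/-! ### Sets that attain Macaulay's bound -/

section Attained

variable {ι : Type*} [DecidableEq ι]

/-- The multiples of `z` of degree `c + 1` in the variables `s`, together with `L`. -/
noncomputable def layer (z : ι) (s : Finset ι) (c : ℕ) (L : Finset (ι →₀ ℕ)) :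
    Finset (ι →₀ ℕ) :=
  translate (Finsupp.single z 1) (s.finsuppAntidiag c) ∪ L

theorem mem_layer {z : ι} {s : Finset ι} {c : ℕ} {L : Finset (ι →₀ ℕ)} {u : ι →₀ ℕ} :
    u ∈ layer z s c L ↔ (∃ m ∈ s.finsuppAntidiag c, Finsupp.single z 1 + m = u) ∨ u ∈ L := by
  rw [layer, mem_union, mem_translate]

theorem translate_subset_mons {s : Finset ι} {w : ι →₀ ℕ} {k d : ℕ}
    (hw : w ∈ s.finsuppAntidiag k) {A : Finset (ι →₀ ℕ)} (hA : A ⊆ s.finsuppAntidiag d) :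
    translate w A ⊆ s.finsuppAntidiag (k + d) := by
  intro u hu
  obtain ⟨m, hm, rfl⟩ := mem_translate.1 hu
  obtain ⟨h1, h2⟩ := mem_mons.1 (hA hm)
  obtain ⟨h3, h4⟩ := mem_mons.1 hw
  exact mem_mons.2 ⟨by rw [map_add, h1, h3], fun i hi => by simp [h2 i hi, h4 i hi]⟩

theorem single_mem_mons {s : Finset ι} {z : ι} (hz : z ∈ s) (k : ℕ) :
    Finsupp.single z k ∈ s.finsuppAntidiag k :=
  mem_mons.2 ⟨Finsupp.degree_single _ _, fun _ hi =>
    Finsupp.single_eq_of_ne (ne_of_mem_of_not_mem hz hi).symm⟩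

theorem layer_subset {z : ι} {s : Finset ι} (hz : z ∈ s) {c : ℕ} {L : Finset (ι →₀ ℕ)}
    (hL : L ⊆ (s.erase z).finsuppAntidiag (c + 1)) : layer z s c L ⊆ s.finsuppAntidiag (c + 1) := by
  refine Finset.union_subset ?_ (hL.trans (finsuppAntidiag_mono (Finset.erase_subset z s) _))
  rw [add_comm]
  exact translate_subset_mons (single_mem_mons hz 1) (Finset.Subset.refl _)

theorem card_layer {z : ι} {s : Finset ι} {c d : ℕ} {L : Finset (ι →₀ ℕ)}
    (hL : L ⊆ (s.erase z).finsuppAntidiag d) :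
    #(layer z s c L) = (#s).multichoose c + #L := by
  rw [layer, Finset.card_union_of_disjoint, card_translate, card_mons]
  rw [Finset.disjoint_left]
  intro u hu hu'
  obtain ⟨m, -, rfl⟩ := mem_translate.1 hu
  have := (mem_mons.1 (hL hu')).2 z (Finset.notMem_erase z s)
  simp at this

/-- The layers do not interact: `z · L` is absorbed by the multiples of `z` of the next degree. -/
theorem shadow_layer {z : ι} {s : Finset ι} (hz : z ∈ s) {c : ℕ} {L : Finset (ι →₀ ℕ)}
    (hL : L ⊆ (s.erase z).finsuppAntidiag (c + 1)) :
    shadow s (layer z s c L) = layer z s (c + 1) (shadow (s.erase z) L) := by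
  ext u
  rw [mem_layer, mem_shadow]
  constructor
  · rintro ⟨i, hi, v, hv, rfl⟩
    rcases mem_layer.1 hv with ⟨m, hm, rfl⟩ | hvL
    · exact Or.inl ⟨m + Finsupp.single i 1, shadow_subset (Finset.Subset.refl _)
        (add_single_mem_shadow hi hm), by rw [add_assoc]⟩
    · by_cases hiz : i = z
      · subst hiz
        exact Or.inl ⟨v, finsuppAntidiag_mono (Finset.erase_subset i s) _ (hL hvL), add_comm _ _⟩
      · exact Or.inr (add_single_mem_shadow (mem_erase.2 ⟨hiz, hi⟩) hvL)
  · rintro (⟨m, hm, rfl⟩ | hu)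
    · rw [← shadow_mons] at hm
      obtain ⟨i, hi, v, hv, rfl⟩ := mem_shadow.1 hm
      exact ⟨i, hi, _, mem_layer.2 (Or.inl ⟨v, hv, rfl⟩), by rw [add_assoc]⟩
    · obtain ⟨i, hi, v, hv, rfl⟩ := mem_shadow.1 hu
      exact ⟨i, mem_of_mem_erase hi, v, mem_layer.2 (Or.inr hv), rfl⟩

theorem multichoose_succ_eq_choose (m c : ℕ) : (m + 1).multichoose c = (c + m).choose m := by
  rw [← multichoose_symm, Nat.multichoose_eq, show c + 1 + m - 1 = c + m by omega]

/-- Macaulay's bound is attained in every sufficiently large degree, by a set that does not contain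
all pure powers. -/
theorem exists_card_shadow_eq {p m : ℕ} (hp : 1 ≤ p) (hpm : p ≤ m) (c : ℕ → ℕ)
    (hc : ∀ j, p ≤ j → j < m → c j ≤ c (j + 1)) {s : Finset ι} (hs : #s = m + 1) {D : ℕ}
    (hD : c m < D) :
    ∃ L ⊆ s.finsuppAntidiag D, #L = ∑ j ∈ Icc p m, (c j + j).choose j ∧
      #(shadow s L) = ∑ j ∈ Icc p m, (c j + j + 1).choose j ∧
      ∃ y ∈ s, Finsupp.single y D ∉ L := by
  have key : ∀ {m : ℕ} {s : Finset ι} {z y : ι} {L' : Finset (ι →₀ ℕ)} {c D a b : ℕ},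
      #s = m + 1 → z ∈ s → y ∈ s.erase z → L' ⊆ (s.erase z).finsuppAntidiag (c + 1) → c < D →
      #L' = a → #(shadow (s.erase z) L') = b → Finsupp.single y (c + 1) ∉ L' →
      ∃ L ⊆ s.finsuppAntidiag D, #L = a + (c + m).choose m ∧
        #(shadow s L) = b + (c + m + 1).choose m ∧ ∃ y ∈ s, Finsupp.single y D ∉ L := by
    intro m s z y L' c D a b hs hz hy hL' hD ha hb hyL
    refine ⟨translate (Finsupp.single z (D - (c + 1))) (layer z s c L'), ?_, ?_, ?_, y,
      mem_of_mem_erase hy, ?_⟩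
    · have h := translate_subset_mons (single_mem_mons hz (D - (c + 1))) (layer_subset hz hL')
      rwa [Nat.sub_add_cancel (by omega)] at h
    · rw [card_translate, card_layer hL', hs, multichoose_succ_eq_choose, ha, add_comm]
    · rw [shadow_translate, card_translate, shadow_layer hz hL', card_layer (shadow_subset hL'),
        hs, multichoose_succ_eq_choose, hb, add_comm, show c + 1 + m = c + m + 1 by omega]
    · intro h
      have hyz := ne_of_mem_erase hy
      obtain ⟨v, hv, hvy⟩ := mem_translate.1 h
      have h1 := DFunLike.congr_fun hvy z
      rw [Finsupp.add_apply, Finsupp.single_eq_same, Finsupp.single_eq_of_ne hyz.symm] at h1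
      -- If the factor `z ^ (D - (c + 1))` were nontrivial, every member would be divisible by `z`,
      -- unlike the pure power of `y`.
      have h2 : D - (c + 1) = 0 := by omega
      rw [h2, Finsupp.single_zero, zero_add] at hvy
      rcases mem_layer.1 hv with ⟨w, -, rfl⟩ | hv
      · simp at h1
      · rw [hvy, show D = c + 1 by omega] at hv
        exact hyL hv
  induction m, hpm using Nat.le_induction generalizing s D with
  | base =>
    obtain ⟨z, hz⟩ : s.Nonempty := Finset.card_pos.1 (by omega)
    obtain ⟨y, hy⟩ : (s.erase z).Nonempty := Finset.card_pos.1 (by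
      rw [Finset.card_erase_of_mem hz]
      omega)
    have h0 : shadow (s.erase z) (∅ : Finset (ι →₀ ℕ)) = ∅ := by
      ext u
      simp [mem_shadow]
    simpa [h0] using key hs hz hy (Finset.empty_subset _) hD rfl rfl (Finset.notMem_empty _)
  | succ m hm ih =>
    obtain ⟨z, hz⟩ : s.Nonempty := Finset.card_pos.1 (by omega)
    have hse : #(s.erase z) = m + 1 := by
      rw [Finset.card_erase_of_mem hz]
      omega
    obtain ⟨L', h1, h2, h3, y, hy, hyL⟩ := ih (fun j h1 h2 => hc j h1 (by omega)) hse
      (Nat.lt_succ_of_le (hc m hm (by omega)))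
    rw [Finset.sum_Icc_succ_top (by omega), Finset.sum_Icc_succ_top (by omega)]
    exact key hs hz hy h1 hD h2 h3 hyL

/-- If the coefficients are not all equal, then Macaulay's bound is attained by a set without
common divisor that, for some set `T` of variables, contains monomials in these variables, but none
of their pure powers. -/
theorem exists_card_shadow_eq_of_lt {p m : ℕ} (hp : 1 ≤ p) (hpm : p ≤ m) (c : ℕ → ℕ)
    (hc : ∀ j, p ≤ j → j < m → c j ≤ c (j + 1)) (hlt : c p < c m) {s : Finset ι}
    (hs : #s = m + 1) :
    ∃ V ⊆ s.finsuppAntidiag (c m + 1), #V = ∑ j ∈ Icc p m, (c j + j).choose j ∧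
      #(shadow s V) = ∑ j ∈ Icc p m, (c j + j + 1).choose j ∧
      (∀ i, ∃ u ∈ V, u i = 0) ∧
      ∃ T : Finset ι, (∃ u ∈ V, ∀ i, i ∉ T → u i = 0) ∧
        ∀ x ∈ T, ∀ k, Finsupp.single x k ∉ V := by
  induction m, hpm using Nat.le_induction generalizing s with
  | base => exact absurd hlt (lt_irrefl _)
  | succ m hm ih =>
    obtain ⟨z, hz⟩ : s.Nonempty := Finset.card_pos.1 (by omega)
    have hse : #(s.erase z) = m + 1 := by
      rw [Finset.card_erase_of_mem hz]
      omega
    have hc' : ∀ j, p ≤ j → j < m → c j ≤ c (j + 1) := fun j h1 h2 => hc j h1 (by omega)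
    obtain ⟨L, hL, h1, h2, T, hT, ⟨u, hu, huT⟩, hpure⟩ : ∃ L ⊆ (s.erase z).finsuppAntidiag
        (c (m + 1) + 1), #L = ∑ j ∈ Icc p m, (c j + j).choose j ∧
        #(shadow (s.erase z) L) = ∑ j ∈ Icc p m, (c j + j + 1).choose j ∧
        ∃ T : Finset ι, z ∉ T ∧ (∃ u ∈ L, ∀ i, i ∉ T → u i = 0) ∧
          ∀ x ∈ T, ∀ k, Finsupp.single x k ∉ L := by
      -- Without a jump at the top the lower layer already has the property. At a jump there is a
      -- spare degree.
      rcases (hc m hm (by omega)).eq_or_lt with heq | hlt'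
      · rw [← heq] at hlt ⊢
        obtain ⟨L, hL, h1, h2, -, T, ⟨u, hu, huT⟩, hpure⟩ := ih hc' hlt hse
        refine ⟨L, hL, h1, h2, T.erase z, Finset.notMem_erase z T, ⟨u, hu, fun i hi => ?_⟩,
          fun x hx => hpure x (mem_of_mem_erase hx)⟩
        by_cases hiz : i = z
        · exact (mem_mons.1 (hL hu)).2 i (hiz ▸ Finset.notMem_erase z s)
        · exact huT i fun h => hi (mem_erase.2 ⟨hiz, h⟩)
      · obtain ⟨L, hL, h1, h2, y, hy, hyL⟩ := exists_card_shadow_eq hp hm c hc' hse hlt'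
        have hLne : L.Nonempty := by
          rw [← Finset.card_pos, h1]
          exact Finset.sum_pos (fun j _ => Nat.choose_pos (by omega))
            ⟨p, Finset.mem_Icc.2 ⟨le_rfl, hm⟩⟩
        -- The spare degree is spent on the variable `y` whose pure power is missing from `L`. In `y
        -- · L` only a power of `y` could be pure, and it would come from that missing power.
        have hsub := translate_subset_mons (single_mem_mons hy 1) hL
        rw [add_comm] at hsub
        refine ⟨_, hsub, (card_translate _ _).trans h1, ?_, s.erase z, Finset.notMem_erase z s,
          ?_, fun x hx k hk => ?_⟩
        · rw [shadow_translate, card_translate, h2]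
        · obtain ⟨u, hu⟩ := hLne
          have hu' : Finsupp.single y 1 + u ∈ translate (Finsupp.single y 1) L :=
            mem_translate.2 ⟨u, hu, rfl⟩
          exact ⟨_, hu', (mem_mons.1 (hsub hu')).2⟩
        · have hdeg := (mem_mons.1 (hsub hk)).1
          rw [Finsupp.degree_single] at hdeg
          obtain ⟨v, hv, hvx⟩ := mem_translate.1 hk
          have hxy : y = x := by
            by_contra hne
            have h3 := DFunLike.congr_fun hvx y
            rw [Finsupp.add_apply, Finsupp.single_eq_same, Finsupp.single_eq_of_ne hne] at h3
            omega
          subst hxy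
          rw [hdeg, add_comm (c (m + 1)), Finsupp.single_add] at hvx
          rw [add_left_cancel hvx] at hv
          exact hyL hv
    refine ⟨layer z s (c (m + 1)) L, layer_subset hz hL, ?_, ?_, fun i => ?_, T, ?_, ?_⟩
    · rw [card_layer hL, hs, multichoose_succ_eq_choose, h1, Finset.sum_Icc_succ_top (by omega),
        add_comm]
    · rw [shadow_layer hz hL, card_layer (shadow_subset hL), hs, multichoose_succ_eq_choose, h2,
        Finset.sum_Icc_succ_top (by omega), add_comm,
        show c (m + 1) + 1 + (m + 1) = c (m + 1) + (m + 1) + 1 by omega]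
    · by_cases hiz : i = z
      · subst hiz
        exact ⟨u, mem_layer.2 (Or.inr hu), huT i hT⟩
      · exact ⟨_, mem_layer.2 (Or.inl ⟨_, single_mem_mons hz _, rfl⟩), by simp [Ne.symm hiz]⟩
    · exact ⟨u, mem_layer.2 (Or.inr hu), huT⟩
    · intro x hx k hk
      have hxz : x ≠ z := ne_of_mem_of_not_mem hx hT
      rcases mem_layer.1 hk with ⟨v, -, hv⟩ | hk
      · have h3 := DFunLike.congr_fun hv z
        rw [Finsupp.add_apply, Finsupp.single_eq_same, Finsupp.single_eq_of_ne hxz.symm] at h3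
        omega
      · exact hpure x hx k hk

end Attained

/-! ### The Gotzmann condition in terms of shadows -/

theorem hilbert_monomialIdeal (K : Type*) [Field K] {n : ℕ} (V W : Finset (Fin n →₀ ℕ)) (t : ℕ)
    (hW : ∀ u, u ∈ W ↔ u ∈ monomials n t ∧ ∃ v ∈ V, v ≤ u) :
    hilbert (monomialIdeal K V) t = #W := by
  have h : Submodule.restrictScalars K (monomialIdeal K V) ⊓
      MvPolynomial.homogeneousSubmodule (Fin n) K t =
        MvPolynomial.restrictSupport K (W : Set (Fin n →₀ ℕ)) := by
    ext f
    rw [Submodule.mem_inf, Submodule.restrictScalars_mem, monomialIdeal,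
      MvPolynomial.mem_ideal_span_monomial_image, MvPolynomial.mem_homogeneousSubmodule,
      MvPolynomial.mem_restrictSupport_iff]
    constructor
    · rintro ⟨h1, h2⟩ u hu
      refine mem_coe.2 ((hW u).2 ⟨mem_mons.2 ⟨?_, by simp⟩, h1 u hu⟩)
      by_contra hne
      exact MvPolynomial.mem_support_iff.1 hu (h2.coeff_eq_zero hne)
    · intro h
      refine ⟨fun u hu => ((hW u).1 (h hu)).2, ?_⟩
      intro u hu
      have h1 := ((hW u).1 (h (MvPolynomial.mem_support_iff.2 hu))).1
      rw [← (mem_mons.1 h1).1]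
      rw [Finsupp.degree_eq_weight_one]
      rfl
  rw [hilbert, h, Module.finrank_eq_card_basis
    (MvPolynomial.basisRestrictSupport K (W : Set (Fin n →₀ ℕ)))]
  simp

theorem isGotzmann_iff (K : Type*) [Field K] {n d : ℕ} {V : Finset (Fin n →₀ ℕ)}
    (hV : V ⊆ monomials n d) :
    IsGotzmann K d V ↔ #(shadow univ V) = upper (n - 1) #V := by
  rw [IsGotzmann, hilbert_monomialIdeal K V V d, hilbert_monomialIdeal K V (shadow univ V) (d + 1)]
  · exact and_iff_right hV
  · intro u
    rw [mem_shadow]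
    constructor
    · rintro ⟨i, hi, v, hv, rfl⟩
      exact ⟨shadow_subset hV (add_single_mem_shadow hi hv), v, hv, le_self_add⟩
    · rintro ⟨hu, v, hv, hvu⟩
      obtain ⟨w, rfl⟩ := exists_add_of_le hvu
      have h1 := (mem_mons.1 hu).1
      rw [map_add, (mem_mons.1 (hV hv)).1] at h1
      obtain ⟨i, rfl⟩ := exists_eq_single_of_degree (Nat.add_left_cancel h1)
      exact ⟨i, mem_univ i, v, hv, rfl⟩
  · intro u
    constructor
    · exact fun hu => ⟨hV hu, u, hu, le_rfl⟩
    · rintro ⟨hu, v, hv, hvu⟩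
      obtain ⟨w, rfl⟩ := exists_add_of_le hvu
      have h1 := (mem_mons.1 hu).1
      rw [map_add, (mem_mons.1 (hV hv)).1] at h1
      have h2 := (Finsupp.degree_eq_zero_iff w).1 (by omega)
      rwa [h2, add_zero]

/-! ### Lex segments, strong stability and permutations of the variables -/

theorem mem_lexSegment {n d a : ℕ} {u : Fin n →₀ ℕ} : u ∈ lexSegment n d a ↔
    u ∈ monomials n d ∧ #{v ∈ monomials n d | toLex u < toLex v} < a := by
  rw [lexSegment, mem_filter]

theorem mem_lexSegment_of_lt {n d a : ℕ} {u v : Fin n →₀ ℕ} (hu : u ∈ lexSegment n d a)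
    (hv : v ∈ monomials n d) (huv : toLex u < toLex v) : v ∈ lexSegment n d a := by
  rw [mem_lexSegment] at hu ⊢
  refine ⟨hv, (Finset.card_le_card fun w hw => ?_).trans_lt hu.2⟩
  obtain ⟨h1, h2⟩ := mem_filter.1 hw
  exact mem_filter.2 ⟨h1, huv.trans h2⟩

theorem eq_lexSegment {n d : ℕ} {U : Finset (Fin n →₀ ℕ)} (hU : U ⊆ monomials n d)
    (hup : ∀ u ∈ U, ∀ v ∈ monomials n d, toLex u < toLex v → v ∈ U) :
    U = lexSegment n d #U := by
  ext u
  rw [mem_lexSegment]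
  constructor
  · intro hu
    refine ⟨hU hu, Finset.card_lt_card ((Finset.ssubset_iff_of_subset fun v hv => ?_).2
      ⟨u, hu, by simp⟩)⟩
    exact hup u hu v (mem_filter.1 hv).1 (mem_filter.1 hv).2
  · rintro ⟨hu, hlt⟩
    by_contra hnot
    refine hlt.not_ge (Finset.card_le_card fun v hv => mem_filter.2 ⟨hU hv, ?_⟩)
    rcases lt_trichotomy (toLex u) (toLex v) with h | h | h
    · exact h
    · exact absurd (toLex.injective h ▸ hv) hnot
    · exact absurd (hup v hv u hu h) hnot

theorem stronglyStable_lexSegment (n d a : ℕ) : StronglyStable (lexSegment n d a) := by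
  intro u hu i j hij huj
  have h1 := (mem_mons.1 (mem_lexSegment.1 hu).1).1
  have h2 := congrArg Finsupp.degree (sub_add_single huj)
  simp only [map_add, Finsupp.degree_single] at h2
  refine mem_lexSegment_of_lt hu (mem_mons.2 ⟨?_, by simp⟩) ?_
  · rw [map_add, Finsupp.degree_single]
    omega
  · refine Finsupp.Lex.lt_iff.2 ⟨i, fun k hk => ?_, ?_⟩
    · simp [hk.ne', (hk.trans hij).ne']
    · simp [hij.ne']

theorem GcdEqOne.eq_zero_of_translate {n : ℕ} {w : Fin n →₀ ℕ} {A : Finset (Fin n →₀ ℕ)}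
    (h : GcdEqOne (translate w A)) : w = 0 := by
  refine le_antisymm (h.2 ?_) zero_le
  intro u hu
  obtain ⟨m, -, rfl⟩ := mem_translate.1 hu
  exact le_self_add

theorem gcdEqOne_of_forall_exists {n : ℕ} {V : Finset (Fin n →₀ ℕ)}
    (h : ∀ i, ∃ u ∈ V, u i = 0) : GcdEqOne V := by
  refine ⟨fun u _ => zero_le, fun w hw i => ?_⟩
  obtain ⟨u, hu, hui⟩ := h i
  rw [Finsupp.zero_apply, ← hui]
  exact hw hu i

/-- Being divisible by one of the first `p` variables passes to lex greater monomials of the same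
degree: up to the first exponent that differs nothing changes, and there the exponent grows. -/
theorem cofaces_eq_lexSegment {n d p : ℕ} :
    cofaces univ (univ.filter fun i : Fin n => p ≤ (i : ℕ)) d =
      lexSegment n d #(cofaces univ (univ.filter fun i : Fin n => p ≤ (i : ℕ)) d) := by
  refine eq_lexSegment Finset.sdiff_subset fun u hu v hv huv => ?_
  obtain ⟨-, i, hi, hui⟩ := mem_cofaces.1 hu
  obtain ⟨k, hk, hlt⟩ := Finsupp.Lex.lt_iff.1 huv
  simp only [ofLex_toLex] at hk hlt
  refine mem_cofaces.2 ⟨hv, ?_⟩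
  rcases lt_or_ge i k with hik | hik
  · exact ⟨i, hi, by rwa [← show u i = v i from hk i hik]⟩
  · refine ⟨k, ?_, (Nat.zero_le _).trans_lt hlt |>.ne'⟩
    simp only [mem_filter, mem_univ, true_and, not_le] at hi ⊢
    exact lt_of_le_of_lt hik hi

theorem permEquiv_cofaces {n d : ℕ} {S S' : Finset (Fin n)} (h : #S = #S') :
    PermEquiv (cofaces univ S d) (cofaces univ S' d) := by
  let e : {x // x ∈ S} ≃ {x // x ∈ S'} := Finset.equivOfCardEq h
  have he : ∀ i, e.extendSubtype i ∈ S' ↔ i ∈ S := by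
    intro i
    constructor
    · intro h1
      by_contra h2
      exact e.extendSubtype_not_mem i h2 h1
    · exact e.extendSubtype_mem i
  have hmem : ∀ u : Fin n →₀ ℕ, u ∈ cofaces univ S d →
      Finsupp.mapDomain e.extendSubtype u ∈ cofaces univ S' d := by
    intro u hu
    obtain ⟨h1, i, hi, hui⟩ := mem_cofaces.1 hu
    refine mem_cofaces.2 ⟨mem_mons.2 ⟨?_, by simp⟩, e.extendSubtype i, ?_, ?_⟩
    · rw [Finsupp.degree_mapDomain]
      exact (mem_mons.1 h1).1
    · rwa [he]
    · rwa [Finsupp.mapDomain_apply e.extendSubtype.injective]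
  refine ⟨e.extendSubtype, Finset.eq_of_subset_of_card_le (fun u hu => ?_) ?_⟩
  · obtain ⟨v, hv, rfl⟩ := mem_image.1 hu
    exact hmem v hv
  · rw [Finset.card_image_of_injective _ (Finsupp.mapDomain_injective e.extendSubtype.injective),
      cofaces, cofaces, Finset.card_sdiff_of_subset (finsuppAntidiag_mono (Finset.subset_univ _) d),
      Finset.card_sdiff_of_subset (finsuppAntidiag_mono (Finset.subset_univ _) d), card_mons,
      card_mons, card_mons, h]

/-- A set that contains monomials in the variables `T`, but no pure powers of them, is not strongly
stable for any order of the variables. -/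
theorem not_stronglyStable_of_permEquiv {n d : ℕ} {V V' : Finset (Fin n →₀ ℕ)}
    (hV : V ⊆ monomials n (d + 1)) {T : Finset (Fin n)} (hT : ∃ u ∈ V, ∀ i, i ∉ T → u i = 0)
    (hpure : ∀ x ∈ T, ∀ k, Finsupp.single x k ∉ V) (hVV' : PermEquiv V V') :
    ¬ StronglyStable V' := by
  intro hst
  obtain ⟨π, rfl⟩ := hVV'
  have hswap : ∀ u ∈ V, ∀ x y, π x < π y → u y ≠ 0 →
      u - Finsupp.single y 1 + Finsupp.single x 1 ∈ V := by
    intro u hu x y hxy huy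
    have h1 := hst _ (mem_image_of_mem _ hu) _ _ hxy (by
      rwa [Finsupp.mapDomain_apply π.injective])
    obtain ⟨v, hv, hvu⟩ := mem_image.1 h1
    have h2 : Finsupp.mapDomain π u = Finsupp.mapDomain π (u - Finsupp.single y 1) +
        Finsupp.single (π y) 1 := by
      rw [← Finsupp.mapDomain_single, ← Finsupp.mapDomain_add, sub_add_single huy]
    rw [h2, add_tsub_cancel_right, ← Finsupp.mapDomain_single, ← Finsupp.mapDomain_add] at hvu
    rwa [← Finsupp.mapDomain_injective π.injective hvu]
  obtain ⟨u, hu, huT⟩ := hT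
  have hTne : T.Nonempty := by
    obtain ⟨i, hi⟩ := exists_ne_zero_of_degree (u := u) (by
      rw [(mem_mons.1 (hV hu)).1]
      omega)
    refine ⟨i, ?_⟩
    by_contra h
    exact hi (huT i h)
  obtain ⟨x, hx, hmin⟩ := Finset.exists_min_image T π hTne
  -- Among the members in the variables `T`, one with the largest exponent of the first variable `x`
  -- must be a pure power of `x`; otherwise an exchange would raise that exponent.
  obtain ⟨v, hv, hmax⟩ := Finset.exists_max_image {u ∈ V | ∀ i, i ∉ T → u i = 0} (fun u => u x)
    ⟨u, mem_filter.2 ⟨hu, huT⟩⟩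
  obtain ⟨hvV, hvT⟩ := mem_filter.1 hv
  refine hpure x hx (v x) ?_
  convert hvV using 1
  ext y
  by_cases hxy : y = x
  · rw [hxy, Finsupp.single_eq_same]
  · rw [Finsupp.single_eq_of_ne hxy]
    by_contra hvy
    have hyT : y ∈ T := by
      by_contra h
      exact hvy (hvT y h).symm
    have hlt : π x < π y := lt_of_le_of_ne (hmin y hyT) fun h => hxy (π.injective h).symm
    have h1 := hmax _ (mem_filter.2 ⟨hswap v hvV x y hlt (Ne.symm hvy), fun i hi => by
      simp [hvT i hi, (ne_of_mem_of_not_mem hx hi).symm]⟩)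
    simp [hxy] at h1

/-! ### The implications between the conditions -/

theorem BinomRep.exists_not_stronglyStable (K : Type*) [Field K] {n a : ℕ}
    (r : BinomRep (n - 1) a) (h : r.coef (n - 1) ≠ r.coef r.bot) :
    ∃ (d : ℕ) (V : Finset (Fin n →₀ ℕ)), IsGotzmann K d V ∧ V.card = a ∧ GcdEqOne V ∧
      ∀ V', PermEquiv V V' → ¬ StronglyStable V' := by
  have hmono : ∀ k, r.bot ≤ k → k ≤ n - 1 → r.coef r.bot ≤ r.coef k := by
    intro k hk
    induction k, hk using Nat.le_induction with
    | base => exact fun _ => le_rfl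
    | succ k hk ih => exact fun hkn => (ih (by omega)).trans (r.coef_le k hk (by omega))
  have h1 := r.one_le_bot
  have h2 := r.bot_le
  obtain ⟨V, hV, hcard, hsh, hgcd, T, hT, hpure⟩ := exists_card_shadow_eq_of_lt h1 h2 r.coef
    r.coef_le (lt_of_le_of_ne (hmono _ h2 le_rfl) h.symm) (s := (Finset.univ : Finset (Fin n)))
    (by rw [Finset.card_fin]; omega)
  rw [r.sum_eq] at hcard
  refine ⟨_, V, (isGotzmann_iff K hV).2 ?_, hcard, gcdEqOne_of_forall_exists hgcd,
    fun V' hVV' => not_stronglyStable_of_permEquiv hV hT hpure hVV'⟩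
  rw [hsh, hcard, upper_eq r]
  rfl

theorem BinomRep.permEquiv_lexSegment (K : Type*) [Field K] {n a : ℕ}
    (r : BinomRep (n - 1) a) (h : r.coef (n - 1) = r.coef r.bot) {d : ℕ}
    {V : Finset (Fin n →₀ ℕ)} (hV : IsGotzmann K d V) (hcard : V.card = a) (hgcd : GcdEqOne V) :
    PermEquiv V (lexSegment n d a) := by
  have h1 := r.one_le_bot
  have h2 := r.bot_le
  have hconst : ∀ k, r.bot ≤ k → k ≤ n - 1 → r.coef k = r.coef r.bot := by
    have hup : ∀ k, r.bot ≤ k → k ≤ n - 1 → r.coef r.bot ≤ r.coef k := by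
      intro k hk
      induction k, hk using Nat.le_induction with
      | base => exact fun _ => le_rfl
      | succ k hk ih => exact fun hkn => (ih (by omega)).trans (r.coef_le k hk (by omega))
    have hdown : ∀ k m, r.bot ≤ k → k ≤ m → m ≤ n - 1 → r.coef k ≤ r.coef m := by
      intro k m hk hkm
      induction m, hkm using Nat.le_induction with
      | base => exact fun _ => le_rfl
      | succ m hm ih => exact fun hmn => (ih (by omega)).trans (r.coef_le m (by omega) (by omega))
    exact fun k hk hkn => le_antisymm ((hdown k _ hk hkn le_rfl).trans h.le) (hup k hk hkn)
  obtain ⟨m, rfl⟩ : ∃ m, n = m + 1 := ⟨n - 1, by omega⟩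
  change r.bot ≤ m at h2
  change ∀ k, r.bot ≤ k → k ≤ m → r.coef k = r.coef r.bot at hconst
  generalize he : r.coef r.bot = e at hconst
  have hIcc : Finset.Icc r.bot (m + 1 - 1) = Finset.Ico r.bot (m + 1) := by
    ext j
    simp only [Finset.mem_Icc, Finset.mem_Ico]
    omega
  have ha : a = binSum (e + 1) r.bot (m + 1) := by
    conv_lhs => rw [← r.sum_eq, hIcc]
    refine Finset.sum_congr rfl fun j hj => ?_
    rw [Finset.mem_Ico] at hj
    rw [hconst j hj.1 (by omega), Nat.multichoose_eq, show e + 1 + j - 1 = e + j by omega]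
  have hshift : r.shift = binSum (e + 1 + 1) r.bot (m + 1) := by
    rw [BinomRep.shift, hIcc]
    refine Finset.sum_congr rfl fun j hj => ?_
    rw [Finset.mem_Ico] at hj
    rw [hconst j hj.1 (by omega), Nat.multichoose_eq, show e + 1 + 1 + j - 1 = e + j + 1 by omega]
  have hVd := hV.1
  have hsh : (shadow Finset.univ V).card = binSum (e + 1 + 1) r.bot (m + 1) := by
    rw [(isGotzmann_iff K hVd).1 hV, hcard, upper_eq r, hshift]
  have hne : V.Nonempty := by
    rw [← Finset.card_pos, hcard, ← r.sum_eq]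
    exact Finset.sum_pos (fun j _ => Nat.choose_pos (by omega))
      ⟨_, Finset.mem_Icc.2 ⟨le_rfl, r.bot_le⟩⟩
  have hn : (Finset.univ : Finset (Fin (m + 1))).card = m + 1 := Finset.card_fin _
  have hdeg : ∀ k, V ⊆ Finset.univ.finsuppAntidiag k → d = k := by
    intro k hk
    obtain ⟨u, hu⟩ := hne
    exact (mem_mons.1 (hVd hu)).1.symm.trans (mem_mons.1 (hk hu)).1
  rcases h2.eq_or_lt with hbot | hbot
  -- The one-term representation: `V` is the set of all monomials of degree `e`, and the identity
  -- permutation suffices.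
  · rw [hbot, binSum_top] at ha hsh
    obtain ⟨w, hw⟩ := eq_translate_mons (s := Finset.univ) (q := e) (by omega) d hVd
      (by rw [hn, hcard, ha]) (by rw [hn, hsh])
    have hw0 : w = 0 := by
      rw [hw] at hgcd
      exact hgcd.eq_zero_of_translate
    rw [hw0, translate_zero] at hw
    obtain rfl := hdeg e hw.le
    refine ⟨1, ?_⟩
    have hlex : V = lexSegment (m + 1) d V.card := eq_lexSegment hVd fun u _ v hv _ => by
      rw [hw]
      exact hv
    rw [← hcard, ← hlex]
    ext u
    simp
  · obtain ⟨w, S, -, hS, hw⟩ := cofaceRigidity (m + 1) Finset.univ hn d V (e + 1) r.bot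
      (by omega) (by omega) hVd (hcard.trans ha) hsh.le
    have hw0 : w = 0 := by
      rw [hw] at hgcd
      exact hgcd.eq_zero_of_translate
    rw [hw0, translate_zero] at hw
    obtain rfl := hdeg (e + 1) (hw.le.trans Finset.sdiff_subset)
    -- The face on the last `r.bot` variables, whose complement is a lex segment.
    let S' : Finset (Fin (m + 1)) := Finset.univ.filter fun i => m + 1 - r.bot ≤ (i : ℕ)
    have hS' : S'.card = r.bot := by
      have h3 : S' = (Finset.univ.filter fun i : Fin (m + 1) => (i : ℕ) < m + 1 - r.bot)ᶜ := by
        ext i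
        simp [S']
      rw [h3, Finset.card_compl, Fintype.card_fin, Fin.card_filter_val_lt]
      omega
    have h3 : PermEquiv V (cofaces Finset.univ S' (e + 1)) := by
      rw [hw]
      exact permEquiv_cofaces (hS.trans hS'.symm)
    have h4 : (cofaces Finset.univ S' (e + 1)).card = a := by
      rw [card_cofaces (Finset.subset_univ _) (by omega), hS', hn]
      exact ha.symm
    rwa [cofaces_eq_lexSegment, h4] at h3

end GotzmannMonomial

theorem theorem1 (K : Type*) [Field K] (n a : ℕ)
    (r : GotzmannMonomial.BinomRep (n - 1) a) :
    List.TFAE [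
      r.coef (n - 1) = r.coef r.bot,
      ∀ (d : ℕ) (V : Finset (Fin n →₀ ℕ)),
        GotzmannMonomial.IsGotzmann K d V → V.card = a → GotzmannMonomial.GcdEqOne V →
          GotzmannMonomial.PermEquiv V (GotzmannMonomial.lexSegment n d a),
      ∀ (d : ℕ) (V : Finset (Fin n →₀ ℕ)),
        GotzmannMonomial.IsGotzmann K d V → V.card = a → GotzmannMonomial.GcdEqOne V →
          ∃ V' : Finset (Fin n →₀ ℕ),
            GotzmannMonomial.PermEquiv V V' ∧ GotzmannMonomial.StronglyStable V'] := by
  tfae_have 1 → 2 := fun h d V hV hcard hgcd => r.permEquiv_lexSegment K h hV hcard hgcd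
  tfae_have 2 → 3 := fun h d V hV hcard hgcd =>
    ⟨_, h d V hV hcard hgcd, GotzmannMonomial.stronglyStable_lexSegment n d a⟩
  tfae_have 3 → 1 := by
    intro h
    by_contra hne
    obtain ⟨d, V, hV, hcard, hgcd, hnot⟩ := r.exists_not_stronglyStable K hne
    obtain ⟨V', h1, h2⟩ := h d V hV hcard hgcd
    exact hnot V' h1 h2
  tfae_finish
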